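/- **Setting.** Fix real numbers $\tfrac12<s\le t<1$, $0<d\le 1$ and $M>0$. For $a\ge 1$, $\theta\in[0,2\pi)$ put $A_a=\begin{pmatrix}a^t&0\\0&a^s\end{pmatrix}$, $R_\theta=\begin{pmatrix}\cos\theta&-\sin\theta\\ \sin\theta&\cos\theta\end{pmatrix}$, $e_\theta=(\cos\theta,\sin\theta)^{\mathrm T}$. Fix a mother wave packet $w$: a Schwartz function on $\mathbb R^2$ whose Fourier transform $\widehat w(\xi)=\int w(x)e^{-2\pi i x\cdot\xi}\,dx$ is real, non-negative and radial, has support equal to the closed ball of radius $d$ about $0$, and satisfies, for some $0<c_1<c_2<\infty$, $$c_1\le\int_0^{2\pi}\!\int_1^\infty a^{-(t+s)}\left|\widehat w\left(A_a^{-1}R_\theta^{-1}(\xi-a e_\theta)\right)\right|^2 a\,da\,d\theta\le c_2\qquad(|\xi|\ge1).$$ Let $w_{a\theta b}(x)=a^{\frac{t+s}2}e^{2\pi i a(x-b)\cdot e_\theta}\,w(A_aR_\theta^{-1}(x-b))$. For $f$ on $\mathbb R^2$ let $$W_f(a,\theta,b)=\int_{\mathbb R^2}\overline{w_{a\theta b}(x)}f(x)\,dx,\qquad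 v_f(a,\theta,b)=\frac{\nabla_bW_f(a,\theta,b)}{2\pi i\,W_f(a,\theta,b)}\quad(W_f(a,\theta,b)\ne0).$$ *Shape functions.* $S:\mathbb R^2\to\mathbb C$ belongs to $S_M$ if it is $(2\pi,2\pi)$-periodic, has unit $L^2([-\pi,\pi]^2)$-norm, satisfies $|S|\le M$, is the uniform limit of its Fourier series $\sum_{n\in\mathbb Z^2}\widehat S(n)e^{in\cdot x}$, where $\widehat S(n)=(2\pi)^{-2}\int_{[-\pi,\pi]^2}S(x)e^{-in\cdot x}dx$, satisfies $\sum_n|\widehat S(n)|\le M$ and $\widehat S(0)=0$, and the greatest common divisor of the absolute values of all coordinates of all $n$ with $\widehat S(n)\neq0$ is $1$. *General intrinsic mode type functions (GIMT).* Let $F$ be a real $2\times2$ matrix and $N>0$. A function $f(x)=\alpha(x)S(2\pi NF\phi(x))$ is a 2D GIMT of type $(M,N,F)$ if $S\in S_M$, $\alpha:\mathbb R^2\to\mathbb R$ and $\phi:\mathbb R^2\to\mathbb R^2$ are $C^\infty$, $|\nabla\alpha|\le M$, $1/M\le\alpha\le M$, and, with $\widetilde\phi_n=n^{\mathrm T}F\phi/|n^{\mathrm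 T}F|$, $$\tfrac1M\le|\nabla\widetilde\phi_n|\le M,\qquad |\nabla^2\widetilde\phi_n|\le M\quad\text{(operator norm of the Hessian)}\qquad\text{whenever }\widehat S(n)\ne0,$$ and moreover $|\nabla\widetilde\phi_{n-m}|\ge\tfrac1M$ whenever $n\neq m$, $\widehat S(n)\ne0$ and $\widehat S(m)\neq0$. For $r>1$, $\varepsilon>0$ define the following sets of $(a,\theta,b)\in[1,\infty)\times[0,2\pi)\times\mathbb R^2$: $$R_\varepsilon=\left\{|W_f(a,\theta,b)|\ge a^{-\frac{s+t}2}\sqrt\varepsilon,\ a\le2MNr\right\},$$ $$Z_n=\left\{\left|A_a^{-1}R_\theta^{-1}\left(a e_\theta-N\nabla(n^{\mathrm T}F\phi)(b)\right)\right|\le d,\ a\le2MNr\right\}.$$ **Theorem.** There is a constant $C>0$, depending only on $M,s,t,d$ (and the fixed $w$), such that for all $r>1$ and $\varepsilon>0$ there is $N_0>0$, depending only on $M,r,s,t,d,\varepsilon$ (and $w$), such that for every $N>N_0$, every real $2\times2$ matrix $F$ with $|n^{\mathrm T}F|\ge1$ for all $n\in\mathbb Z^2\setminus\{0\}$, and every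 2D GIMT $f(x)=\alpha(x)S(2\pi NF\phi(x))$ of type $(M,N,F)$: (i) the sets $Z_n$ with $\widehat S(n)\ne0$ are pairwise disjoint, and $R_\varepsilon\subset\bigcup_{\widehat S(n)\neq0}Z_n$; (ii) for every $n$ with $\widehat S(n)\ne0$ and every $(a,\theta,b)\in R_\varepsilon\cap Z_n$, $W_f(a,\theta,\cdot)$ is differentiable at $b$ and $$\frac{\left|v_f(a,\theta,b)-N\nabla(n^{\mathrm T}F\phi)(b)\right|}{\left|N\nabla(n^{\mathrm T}F\phi)(b)\right|}\le C\sqrt\varepsilon .$$ -/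

import Mathlib

open MeasureTheory Filter Set
open scoped FourierTransform ContDiff SchwartzMap Matrix ComplexConjugate

noncomputable section

namespace CrystalSST

/-- The plane `ℝ²` with its Euclidean norm. -/
abbrev Plane : Type := EuclideanSpace ℝ (Fin 2)

/-! ### Shape functions -/

/-- The pairing `n · x = n₁ x₁ + n₂ x₂` of an integer vector with a point of the plane. -/
def intDot (n : Fin 2 → ℤ) (x : Plane) : ℝ := ∑ i, (n i : ℝ) * x i

/-- The square `[-π, π]²`. -/
def periodSquare : Set Plane := {x | ∀ i, x i ∈ Icc (-Real.pi) Real.pi}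

/-- The Fourier coefficient `Ŝ(n) = (2π)⁻² ∫_{[-π,π]²} S(x) e^{-i n·x} dx`, so that the Fourier
series of `S` is `∑ Ŝ(n) e^{i n·x}`. -/
def fourierCoeff2 (S : Plane → ℂ) (n : Fin 2 → ℤ) : ℂ :=
  (1 / (2 * (Real.pi : ℂ)) ^ 2) *
    ∫ x in periodSquare, S x * Complex.exp (-(Complex.I * (intDot n x : ℂ)))

/-- The set of `n ∈ ℤ²` with `Ŝ(n) ≠ 0`. -/
def spectrum2 (S : Plane → ℂ) : Set (Fin 2 → ℤ) := {n | fourierCoeff2 S n ≠ 0}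

/-- The class `S_M` of two-dimensional general shape functions (complex values are allowed). -/
structure IsShapeFunction (M : ℝ) (S : Plane → ℂ) : Prop where
  periodic : ∀ (x : Plane) (i : Fin 2),
    S (x + EuclideanSpace.single i (2 * Real.pi)) = S x
  norm_two : ∫ x in periodSquare, ‖S x‖ ^ 2 = 1
  norm_sup : ∀ x, ‖S x‖ ≤ M
  /-- The Fourier series converges uniformly to `S`. -/
  series : TendstoUniformly
    (fun (A : Finset (Fin 2 → ℤ)) (x : Plane) =>
      ∑ n ∈ A, fourierCoeff2 S n * Complex.exp (Complex.I * (intDot n x : ℂ))) S atTop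
  summable : Summable fun n => ‖fourierCoeff2 S n‖
  tsum_le : ∑' n, ‖fourierCoeff2 S n‖ ≤ M
  mean_zero : fourierCoeff2 S 0 = 0
  /-- The absolute values of all the coordinates of all the `n` with `Ŝ(n) ≠ 0` have greatest
  common divisor `1`. -/
  gcd_eq_one : ∀ g : ℕ, (∀ n ∈ spectrum2 S, ∀ i, g ∣ (n i).natAbs) → g = 1

/-! ### General intrinsic mode type functions -/

/-- The row vector `nᵀ F`. -/
def rowVec (F : Matrix (Fin 2) (Fin 2) ℝ) (n : Fin 2 → ℤ) : Plane :=
  WithLp.toLp 2 ((fun i => (n i : ℝ)) ᵥ* F)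

/-- The scalar function `x ↦ nᵀ F φ(x)`. -/
def phase (F : Matrix (Fin 2) (Fin 2) ℝ) (φ : Plane → Plane) (n : Fin 2 → ℤ) (x : Plane) : ℝ :=
  inner ℝ (rowVec F n) (φ x)

/-- The normalized phase `x ↦ nᵀ F φ(x) / |nᵀ F|`. -/
def normPhase (F : Matrix (Fin 2) (Fin 2) ℝ) (φ : Plane → Plane) (n : Fin 2 → ℤ) (x : Plane) : ℝ :=
  phase F φ n x / ‖rowVec F n‖

/-- `f(x) = α(x) S(2π N F φ(x))` is a two-dimensional general intrinsic mode type function of type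
`(M, N, F)` with amplitude `α`, shape function `S` and deformation `φ`. -/
structure IsGIMT (M N : ℝ) (F : Matrix (Fin 2) (Fin 2) ℝ) (α : Plane → ℝ) (S : Plane → ℂ)
    (φ : Plane → Plane) (f : Plane → ℂ) : Prop where
  eq : ∀ x, f x = (α x : ℂ) * S ((2 * Real.pi * N) • Matrix.toEuclideanLin F (φ x))
  shape : IsShapeFunction M S
  amp_smooth : ContDiff ℝ ∞ α
  amp_grad : ∀ x, ‖gradient α x‖ ≤ M
  amp_lower : ∀ x, 1 / M ≤ α x
  amp_upper : ∀ x, α x ≤ M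
  phase_smooth : ContDiff ℝ ∞ φ
  grad_lower : ∀ n ∈ spectrum2 S, ∀ x, 1 / M ≤ ‖gradient (normPhase F φ n) x‖
  grad_upper : ∀ n ∈ spectrum2 S, ∀ x, ‖gradient (normPhase F φ n) x‖ ≤ M
  /-- The operator norm of the Hessian is bounded by `M`. -/
  hess_upper : ∀ n ∈ spectrum2 S, ∀ x, ‖fderiv ℝ (gradient (normPhase F φ n)) x‖ ≤ M
  /-- The lower gradient bound also holds for differences of two distinct frequencies of `S`;
  this is what separates the local wave vectors of different components. -/
  grad_sep : ∀ n ∈ spectrum2 S, ∀ m ∈ spectrum2 S, n ≠ m →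
    ∀ x, 1 / M ≤ ‖gradient (normPhase F φ (n - m)) x‖

/-- The local wave vector `N ∇(nᵀ F φ)(b)`. -/
def localWaveVector (N : ℝ) (F : Matrix (Fin 2) (Fin 2) ℝ) (φ : Plane → Plane) (n : Fin 2 → ℤ)
    (b : Plane) : Plane :=
  N • gradient (phase F φ n) b

/-! ### General wave packets -/

/-- The scaling matrix `A_a = diag(a^t, a^s)`. -/
def scalingMatrix (s t a : ℝ) : Matrix (Fin 2) (Fin 2) ℝ := !![a ^ t, 0; 0, a ^ s]

/-- The rotation matrix `R_θ`. -/
def rotationMatrix (θ : ℝ) : Matrix (Fin 2) (Fin 2) ℝ :=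
  !![Real.cos θ, -Real.sin θ; Real.sin θ, Real.cos θ]

/-- The unit vector `e_θ = (cos θ, sin θ)ᵀ`. -/
def unitVec (θ : ℝ) : Plane := !₂[Real.cos θ, Real.sin θ]

/-- `A_a⁻¹ R_θ⁻¹ v`. -/
def freqMap (s t a θ : ℝ) (v : Plane) : Plane :=
  Matrix.toEuclideanLin ((scalingMatrix s t a)⁻¹ * (rotationMatrix θ)⁻¹) v

/-- `A_a R_θ⁻¹ x`. -/
def spaceMap (s t a θ : ℝ) (x : Plane) : Plane :=
  Matrix.toEuclideanLin (scalingMatrix s t a * (rotationMatrix θ)⁻¹) x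

/-- `w` is a mother wave packet for the geometric parameters `s`, `t` with Fourier support radius
`d`; the Fourier transform is `ŵ(ξ) = ∫ w(x) e^{-2πi x·ξ} dx`. -/
structure IsMotherWavePacket (s t d : ℝ) (w : 𝓢(Plane, ℂ)) : Prop where
  real : ∀ ξ : Plane, (𝓕 w ξ).im = 0
  nonneg : ∀ ξ : Plane, 0 ≤ (𝓕 w ξ).re
  radial : ∀ ξ η : Plane, ‖ξ‖ = ‖η‖ → 𝓕 w ξ = 𝓕 w η
  support_eq : tsupport (fun ξ : Plane => 𝓕 w ξ) = Metric.closedBall 0 d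
  admissible : ∃ c₁ c₂ : ℝ, 0 < c₁ ∧ c₁ < c₂ ∧ ∀ ξ : Plane, 1 ≤ ‖ξ‖ →
    c₁ ≤ (∫ θ in (0 : ℝ)..(2 * Real.pi), ∫ a in Ioi (1 : ℝ),
        a ^ (-(t + s)) * ‖𝓕 w (freqMap s t a θ (ξ - a • unitVec θ))‖ ^ 2 * a) ∧
    (∫ θ in (0 : ℝ)..(2 * Real.pi), ∫ a in Ioi (1 : ℝ),
        a ^ (-(t + s)) * ‖𝓕 w (freqMap s t a θ (ξ - a • unitVec θ))‖ ^ 2 * a) ≤ c₂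

/-- The general wave packet
`w_{aθb}(x) = a^{(t+s)/2} e^{2πi a (x-b)·e_θ} w(A_a R_θ⁻¹ (x-b))`. -/
def wavePacket (s t : ℝ) (w : 𝓢(Plane, ℂ)) (a θ : ℝ) (b x : Plane) : ℂ :=
  ((a ^ ((t + s) / 2) : ℝ) : ℂ) *
    Complex.exp (2 * Real.pi * Complex.I * (a * inner ℝ (x - b) (unitVec θ) : ℝ)) *
    w (spaceMap s t a θ (x - b))

/-- The general wave packet transform `W_f(a, θ, b) = ∫ conj(w_{aθb}(x)) f(x) dx`. -/
def transform (s t : ℝ) (w : 𝓢(Plane, ℂ)) (f : Plane → ℂ) (a θ : ℝ) (b : Plane) : ℂ :=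
  ∫ x, conj (wavePacket s t w a θ b x) * f x

/-- The local wave-vector estimate `v_f = ∇_b W_f / (2πi W_f)`, a vector in `ℂ²`. -/
def waveVectorEstimate (s t : ℝ) (w : 𝓢(Plane, ℂ)) (f : Plane → ℂ) (a θ : ℝ) (b : Plane) :
    EuclideanSpace ℂ (Fin 2) :=
  WithLp.toLp 2 fun i =>
    fderiv ℝ (fun b' => transform s t w f a θ b') b (EuclideanSpace.single i 1) /
      (2 * Real.pi * Complex.I * transform s t w f a θ b)

/-- A real vector regarded as a vector in `ℂ²`. -/
def toComplex (v : Plane) : EuclideanSpace ℂ (Fin 2) := WithLp.toLp 2 fun i => (v i : ℂ)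

/-- The parameters `(a, θ, b)` with `a ∈ [1, L]`, `θ ∈ [0, 2π)`, `b ∈ ℝ²`. -/
def paramDomain (L : ℝ) : Set (ℝ × ℝ × Plane) :=
  {p | 1 ≤ p.1 ∧ p.1 ≤ L ∧ 0 ≤ p.2.1 ∧ p.2.1 < 2 * Real.pi}

/-- The set `R_ε`. -/
def setR (s t : ℝ) (w : 𝓢(Plane, ℂ)) (M N r ε : ℝ) (f : Plane → ℂ) : Set (ℝ × ℝ × Plane) :=
  {p | p ∈ paramDomain (2 * M * N * r) ∧
    p.1 ^ (-((s + t) / 2)) * √ε ≤ ‖transform s t w f p.1 p.2.1 p.2.2‖}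

/-- The set `Z_n`. -/
def setZ (s t d M N r : ℝ) (F : Matrix (Fin 2) (Fin 2) ℝ) (φ : Plane → Plane) (n : Fin 2 → ℤ) :
    Set (ℝ × ℝ × Plane) :=
  {p | p ∈ paramDomain (2 * M * N * r) ∧
    ‖freqMap s t p.1 p.2.1 (p.1 • unitVec p.2.1 - localWaveVector N F φ n p.2.2)‖ ≤ d}

end CrystalSST

end

noncomputable section

namespace CrystalSST

/-! ### Oscillatory integrals with slowly varying data -/

/-! The Fourier series of S writes f as a sum of waves `Ŝ(n) α e^{2πiN nᵀFφ}` with ℓ¹-bounded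
coefficients. In the variable y, where x = b + R_θ A_a⁻¹ y, the transform of each wave is an
integral of `conj w` against a slowly varying amplitude and an oscillation, times the factor
a^{-(s+t)/2} that also appears in R_ε.

The core is `exists_packetIntegral_le`: if ŵ vanishes at the rescaled offset between the local wave
vector and a e_θ, the integral is small once the frequency Λ = N|nᵀF| is large, uniformly in n. When
a ≳ Λ, the amplitude is frozen and the phase linearized at b; the main term is a multiple of the
conjugate of ŵ at that offset, hence zero, and the errors are O(a^{1-2s}), which is where s > 1/2 is
used. When a ≲ Λ, the phase gradient is of size at least Λ everywhere, and t < 1 keeps the rescaled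
phase fast; averaging over small translations and the Riemann–Lebesgue lemma give the decay. Summing
over n, a point outside every Z_n cannot lie in R_ε.

On Z_n the local wave vector is within a^t of a e_θ. Two distinct local wave vectors are at least
N/M apart, while a^t = O(N^t) by the upper bound on a, so the zones are disjoint for large N.

The estimate needs no decomposition of W_f. Differentiating the kernel gives 2πi a e_θ W_f plus a
term of relative size a^t/√ε on R_ε. Thus v_f and the local wave vector are both a e_θ + O(a^t),
with constants depending on ε. Their relative difference is O(a^{t-1}), and a ≳ N on Z_n. -/

theorem norm_fourierChar_sub_le (x y : ℝ) :
    ‖(Real.fourierChar x : ℂ) - (Real.fourierChar y : ℂ)‖ ≤ 2 * Real.pi * |x - y| := by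
  have h : (Real.fourierChar x : ℂ) - (Real.fourierChar y : ℂ) =
      (Real.fourierChar y : ℂ) * (Complex.exp (Complex.I * ((2 * Real.pi * (x - y) : ℝ) : ℂ)) - 1) := by
    rw [Real.fourierChar_apply, Real.fourierChar_apply, mul_sub, ← Complex.exp_add, mul_one]
    congr 2
    push_cast
    ring
  rw [h, norm_mul, Circle.norm_coe, one_mul]
  refine (Real.norm_exp_I_mul_ofReal_sub_one_le (x := 2 * Real.pi * (x - y))).trans ?_
  rw [Real.norm_eq_abs, abs_mul, abs_of_pos Real.two_pi_pos]

theorem continuous_fourierChar_comp {X : Type*} [TopologicalSpace X] {G : X → ℝ}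
    (hG : Continuous G) : Continuous fun y => (Real.fourierChar (G y) : ℂ) := by
  have : (fun y => (Real.fourierChar (G y) : ℂ)) =
      fun y => Complex.exp ((2 * Real.pi * G y : ℝ) * Complex.I) := by
    ext y; rw [Real.fourierChar_apply]
  rw [this]; fun_prop

theorem integrable_oscillatory (w : 𝓢(Plane, ℂ)) {β G : Plane → ℝ} {B : ℝ}
    (hβ : Continuous β) (hG : Continuous G) (hB : ∀ y, |β y| ≤ B) :
    Integrable fun y => conj (w y) * ((β y : ℂ) * (Real.fourierChar (G y) : ℂ)) := by
  have hw : Integrable fun y => conj (w y) :=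
    (Complex.conjLIE.toContinuousLinearEquiv.toContinuousLinearMap).integrable_comp w.integrable
  refine hw.mul_bdd (c := B) ?_ (ae_of_all _ fun y => ?_)
  · have := continuous_fourierChar_comp hG
    exact Continuous.aestronglyMeasurable (by fun_prop)
  · rw [norm_mul, Circle.norm_coe, mul_one, Complex.norm_real]
    exact hB y

theorem conj_fourier_eq (w : 𝓢(Plane, ℂ)) (v : Plane) :
    conj (𝓕 w v) = ∫ y, conj (w y) * (Real.fourierChar (inner ℝ v y) : ℂ) := by
  rw [SchwartzMap.fourier_coe, Real.fourier_eq, ← integral_conj]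
  refine integral_congr_ae (ae_of_all _ fun y => ?_)
  simp only [Circle.smul_def, smul_eq_mul, map_mul]
  rw [mul_comm, ← Circle.coe_inv_eq_conj, ← AddChar.map_neg_eq_inv, neg_neg, real_inner_comm]

/-- Freezing β at 0 and linearizing G there turns the integral into a conjugate value of ŵ. The
pointwise price is L‖y‖ for the amplitude and 2πBH‖y‖² for the phase, both integrable against |w|.
-/
theorem norm_oscillatory_sub_fourier_le (w : 𝓢(Plane, ℂ)) {β G : Plane → ℝ} (v : Plane)
    {B L H : ℝ} (hβ : Continuous β) (hG : Continuous G) (hB : ∀ y, |β y| ≤ B)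
    (hL : ∀ y, |β y - β 0| ≤ L * ‖y‖)
    (hH : ∀ y, |G y - G 0 - inner ℝ v y| ≤ H * ‖y‖ ^ 2) :
    ‖(∫ y, conj (w y) * ((β y : ℂ) * (Real.fourierChar (G y) : ℂ))) -
        (β 0 : ℂ) * (Real.fourierChar (G 0) : ℂ) * conj (𝓕 w v)‖ ≤
      L * (∫ y, ‖y‖ ^ 1 * ‖w y‖) + 2 * Real.pi * B * H * ∫ y, ‖y‖ ^ 2 * ‖w y‖ := by
  have hmain : (β 0 : ℂ) * (Real.fourierChar (G 0) : ℂ) * conj (𝓕 w v) =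
      ∫ y, conj (w y) * ((β 0 : ℂ) * (Real.fourierChar (G 0 + inner ℝ v y) : ℂ)) := by
    rw [conj_fourier_eq, ← integral_const_mul]
    refine integral_congr_ae (ae_of_all _ fun y => ?_)
    simp only [AddChar.map_add_eq_mul, Circle.coe_mul]
    ring
  rw [hmain, ← integral_sub (integrable_oscillatory w hβ hG hB)
    (integrable_oscillatory w (β := fun _ => β 0) continuous_const (by fun_prop)
      fun _ => hB 0), ← integral_const_mul, ← integral_const_mul,
    ← integral_add ((w.integrable_pow_mul _ 1).const_mul _)
      ((w.integrable_pow_mul _ 2).const_mul _)]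
  refine norm_integral_le_of_norm_le (((w.integrable_pow_mul _ 1).const_mul _).add
      ((w.integrable_pow_mul _ 2).const_mul _)) (ae_of_all _ fun y => ?_)
  have h1 : conj (w y) * ((β y : ℂ) * (Real.fourierChar (G y) : ℂ)) -
      conj (w y) * ((β 0 : ℂ) * (Real.fourierChar (G 0 + inner ℝ v y) : ℂ)) =
      conj (w y) * (((β y - β 0 : ℝ) : ℂ) * (Real.fourierChar (G y) : ℂ) + (β 0 : ℂ) *
        ((Real.fourierChar (G y) : ℂ) - (Real.fourierChar (G 0 + inner ℝ v y) : ℂ))) := by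
    push_cast; ring
  have h2 : ‖(Real.fourierChar (G y) : ℂ) - (Real.fourierChar (G 0 + inner ℝ v y) : ℂ)‖ ≤
      2 * Real.pi * (H * ‖y‖ ^ 2) := by
    refine (norm_fourierChar_sub_le _ _).trans ?_
    gcongr
    rw [← sub_sub]
    exact hH y
  have hB0 : 0 ≤ B := (abs_nonneg _).trans (hB 0)
  rw [h1, norm_mul, RCLike.norm_conj]
  calc ‖w y‖ * _ ≤ ‖w y‖ * (L * ‖y‖ + B * (2 * Real.pi * (H * ‖y‖ ^ 2))) := by
        gcongr
        refine (norm_add_le _ _).trans (add_le_add ?_ ?_)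
        · rw [norm_mul, Circle.norm_coe, mul_one, Complex.norm_real]
          exact hL y
        · rw [norm_mul, Complex.norm_real]
          exact mul_le_mul (hB 0) h2 (norm_nonneg _) hB0
    _ = _ := by simp only [pow_one]; ring

/-! ### Averaging over small translations in place of integration by parts -/

theorem integrable_prod_translate {χ : Plane → ℝ} {U : Plane → ℂ} (hχc : Continuous χ)
    (hχi : Integrable χ) (hUc : Continuous U) (hUi : Integrable U) (h : ℝ) :
    Integrable (Function.uncurry fun y z : Plane => (χ z : ℂ) * U (y + h • z))
      ((volume : Measure Plane).prod volume) := by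
  have hc : Continuous (Function.uncurry fun y z : Plane => (χ z : ℂ) * U (y + h • z)) := by
    unfold Function.uncurry; fun_prop
  rw [integrable_prod_iff' hc.aestronglyMeasurable]
  refine ⟨ae_of_all _ fun z => (hUi.comp_add_right (h • z)).const_mul (χ z : ℂ), ?_⟩
  have : (fun z : Plane => ∫ y, ‖Function.uncurry
      (fun y z : Plane => (χ z : ℂ) * U (y + h • z)) (y, z)‖) =
      fun z => ‖χ z‖ * ∫ y, ‖U y‖ := by
    ext z
    simp only [Function.uncurry, norm_mul, Complex.norm_real]
    rw [integral_const_mul, integral_add_right_eq_self (fun y => ‖U y‖)]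
  rw [this]
  exact hχi.norm.mul_const _

/-- All translates of U have the same integral, so averaging them against a probability density
changes nothing. -/
theorem integral_eq_integral_average {χ : Plane → ℝ} {U : Plane → ℂ} (hχc : Continuous χ)
    (hχi : Integrable χ) (hχ1 : ∫ z, χ z = 1) (hUc : Continuous U) (hUi : Integrable U) (h : ℝ) :
    ∫ y, U y = ∫ y, ∫ z, (χ z : ℂ) * U (y + h • z) := by
  rw [integral_integral_swap (integrable_prod_translate hχc hχi hUc hUi h)]
  have : ∀ z : Plane, ∫ y, (χ z : ℂ) * U (y + h • z) = (χ z : ℂ) * ∫ y, U y := fun z => by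
    rw [integral_const_mul, integral_add_right_eq_self U]
  simp_rw [this]
  rw [integral_mul_const, integral_complex_ofReal, hχ1, Complex.ofReal_one, one_mul]

/-- A non-stationary phase bound needing only first-order Taylor control of G. Within distance h of
y everything except the linear part of the phase is frozen, at the cost of the B h, L h and H h²
terms; the z-average of what remains is a Fourier integral of χ at h Γ(y), bounded by ρ. -/
theorem norm_oscillatory_le (w : 𝓢(Plane, ℂ)) {β G : Plane → ℝ} (Γ : Plane → Plane)
    {χ g : Plane → ℝ} {B L H h K ρ : ℝ} (hβ : Continuous β) (hG : Continuous G)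
    (hB : ∀ y, |β y| ≤ B) (hL : ∀ y z, |β (y + z) - β y| ≤ L * ‖z‖)
    (hH : ∀ y z, |G (y + z) - G y - inner ℝ (Γ y) z| ≤ H * ‖z‖ ^ 2) (hK : ∀ y, K ≤ ‖Γ y‖)
    (hL0 : 0 ≤ L) (hH0 : 0 ≤ H) (hh : 0 < h) (hh1 : h ≤ 1)
    (hχc : Continuous χ) (hχi : Integrable χ) (hχ1 : ∫ z, χ z = 1) (hχ0 : ∀ z, 0 ≤ χ z)
    (hχs : ∀ z, χ z ≠ 0 → ‖z‖ ≤ 1)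
    (hρ : ∀ ξ : Plane, h * K ≤ ‖ξ‖ →
      ‖∫ z, (χ z : ℂ) * (Real.fourierChar (inner ℝ ξ z) : ℂ)‖ ≤ ρ)
    (hgi : Integrable g) (hg : ∀ y z, ‖z‖ ≤ 1 → ‖w (y + z) - w y‖ ≤ ‖z‖ * g y) :
    ‖∫ y, conj (w y) * ((β y : ℂ) * (Real.fourierChar (G y) : ℂ))‖ ≤
      B * h * (∫ y, g y) + (L * h + B * (2 * Real.pi * (H * h ^ 2)) + B * ρ) * ∫ y, ‖w y‖ := by
  have hB0 : 0 ≤ B := (abs_nonneg _).trans (hB 0)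
  set u : Plane → ℂ := fun y => conj (w y) * (β y : ℂ) with hu
  have hwc : Continuous w := w.continuous
  have huc : Continuous u := by fun_prop
  have hGe := continuous_fourierChar_comp hG
  have hU : (fun y => conj (w y) * ((β y : ℂ) * (Real.fourierChar (G y) : ℂ))) =
      fun y => u y * (Real.fourierChar (G y) : ℂ) := by ext y; simp only [hu]; ring
  have hUi : Integrable fun y => u y * (Real.fourierChar (G y) : ℂ) :=
    hU ▸ integrable_oscillatory w hβ hG hB
  rw [hU, integral_eq_integral_average hχc hχi hχ1 (by fun_prop) hUi h, ← integral_const_mul,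
    ← integral_const_mul, ← integral_add (hgi.const_mul _) (w.integrable.norm.const_mul _)]
  refine norm_integral_le_of_norm_le ((hgi.const_mul _).add (w.integrable.norm.const_mul _))
    (ae_of_all _ fun y => ?_)
  have huB : ∀ y, ‖u y‖ ≤ B * ‖w y‖ := fun y => by
    rw [hu, norm_mul, RCLike.norm_conj, Complex.norm_real, mul_comm]
    exact mul_le_mul_of_nonneg_right (hB y) (norm_nonneg _)
  have hdiff : ∀ z, ‖z‖ ≤ 1 → ‖u (y + h • z) - u y‖ ≤ B * h * g y + L * h * ‖w y‖ := fun z hz => by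
    have hhz : ‖h • z‖ ≤ h := by
      rw [norm_smul, Real.norm_eq_abs, abs_of_pos hh]
      exact mul_le_of_le_one_right hh.le hz
    have hg0 : ‖w (y + h • z) - w y‖ ≤ h * g y := by
      have h1 := hg y (h • z) (hhz.trans hh1)
      -- The sign of g is not assumed. It is recovered from `hg`, at a unit vector when h • z = 0
      -- and at h • z itself otherwise.
      rcases (norm_nonneg (h • z)).eq_or_lt with h0 | h0
      · rw [norm_eq_zero.1 h0.symm, add_zero, sub_self, norm_zero]
        have := hg y (EuclideanSpace.single 0 1) (by simp)
        simp only [PiLp.norm_single, norm_one, one_mul] at this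
        exact mul_nonneg hh.le ((norm_nonneg _).trans this)
      · have : 0 ≤ g y := by
          by_contra! hneg
          exact absurd h1 (not_le.2 ((mul_neg_of_pos_of_neg h0 hneg).trans_le (norm_nonneg _)))
        exact h1.trans (mul_le_mul_of_nonneg_right hhz this)
    have e : u (y + h • z) - u y = conj (w (y + h • z) - w y) * (β (y + h • z) : ℂ) +
        conj (w y) * ((β (y + h • z) - β y : ℝ) : ℂ) := by
      simp only [hu, map_sub]; push_cast; ring
    rw [e]
    refine (norm_add_le _ _).trans (add_le_add ?_ ?_)
    · rw [norm_mul, RCLike.norm_conj, Complex.norm_real, mul_comm, mul_assoc]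
      exact mul_le_mul (hB _) hg0 (norm_nonneg _) hB0
    · rw [norm_mul, RCLike.norm_conj, Complex.norm_real, mul_comm]
      refine mul_le_mul_of_nonneg_right ((hL _ _).trans ?_) (norm_nonneg _)
      exact mul_le_mul_of_nonneg_left hhz hL0
  have hchi : Integrable fun z => (χ z : ℂ) := hχi.ofReal
  have hi1 : Integrable fun z => (χ z : ℂ) * (u (y + h • z) *
      (Real.fourierChar (G (y + h • z)) : ℂ)) := by
    refine Integrable.mono' (hχi.mul_const
      (B * h * g y + L * h * ‖w y‖ + B * ‖w y‖)) (by fun_prop) (ae_of_all _ fun z => ?_)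
    rw [norm_mul, norm_mul, Circle.norm_coe, mul_one, Complex.norm_real, Real.norm_eq_abs,
      abs_of_nonneg (hχ0 z)]
    rcases eq_or_ne (χ z) 0 with h0 | h0
    · simp [h0]
    · refine mul_le_mul_of_nonneg_left ?_ (hχ0 z)
      calc ‖u (y + h • z)‖ = ‖(u (y + h • z) - u y) + u y‖ := by rw [sub_add_cancel]
        _ ≤ _ := (norm_add_le _ _).trans (add_le_add (hdiff z (hχs z h0)) (huB y))
  have hi2 : Integrable fun z => (u y * (Real.fourierChar (G y) : ℂ)) *
      ((χ z : ℂ) * (Real.fourierChar (inner ℝ (h • Γ y) z) : ℂ)) := by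
    refine Integrable.const_mul (hchi.mul_bdd (c := 1) ?_ (ae_of_all _ fun z => ?_)) _
    · exact (continuous_fourierChar_comp (by fun_prop)).aestronglyMeasurable
    · rw [Circle.norm_coe]
  have key : ∀ z, ‖(χ z : ℂ) * (u (y + h • z) * (Real.fourierChar (G (y + h • z)) : ℂ)) -
      (u y * (Real.fourierChar (G y) : ℂ)) *
      ((χ z : ℂ) * (Real.fourierChar (inner ℝ (h • Γ y) z) : ℂ))‖ ≤
      χ z * (B * h * g y + (L * h + B * (2 * Real.pi * (H * h ^ 2))) * ‖w y‖) := fun z => by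
    have e : (χ z : ℂ) * (u (y + h • z) * (Real.fourierChar (G (y + h • z)) : ℂ)) -
      (u y * (Real.fourierChar (G y) : ℂ)) *
      ((χ z : ℂ) * (Real.fourierChar (inner ℝ (h • Γ y) z) : ℂ)) =
      (χ z : ℂ) * ((u (y + h • z) - u y) * (Real.fourierChar (G (y + h • z)) : ℂ) +
        u y * ((Real.fourierChar (G (y + h • z)) : ℂ) -
          (Real.fourierChar (G y + inner ℝ (h • Γ y) z) : ℂ))) := by
      rw [AddChar.map_add_eq_mul, Circle.coe_mul]; ring
    rw [e, norm_mul, Complex.norm_real, Real.norm_eq_abs, abs_of_nonneg (hχ0 z)]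
    rcases eq_or_ne (χ z) 0 with h0 | h0
    · simp [h0]
    refine mul_le_mul_of_nonneg_left ?_ (hχ0 z)
    have hz := hχs z h0
    have h2 : ‖(Real.fourierChar (G (y + h • z)) : ℂ) -
        (Real.fourierChar (G y + inner ℝ (h • Γ y) z) : ℂ)‖ ≤ 2 * Real.pi * (H * h ^ 2) := by
      refine (norm_fourierChar_sub_le _ _).trans ?_
      gcongr
      rw [← sub_sub, real_inner_smul_left, ← real_inner_smul_right]
      refine (hH _ _).trans (mul_le_mul_of_nonneg_left ?_ hH0)
      refine pow_le_pow_left₀ (norm_nonneg _) ?_ 2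
      rw [norm_smul, Real.norm_eq_abs, abs_of_pos hh]
      exact mul_le_of_le_one_right hh.le hz
    calc _ ≤ (B * h * g y + L * h * ‖w y‖) + (B * ‖w y‖) * (2 * Real.pi * (H * h ^ 2)) := by
          refine (norm_add_le _ _).trans (add_le_add ?_ ?_)
          · rw [norm_mul, Circle.norm_coe, mul_one]
            exact hdiff z hz
          · rw [norm_mul]
            exact mul_le_mul (huB y) h2 (norm_nonneg _) (mul_nonneg hB0 (norm_nonneg _))
      _ = _ := by ring
  have hmain : ‖∫ z, (u y * (Real.fourierChar (G y) : ℂ)) *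
      ((χ z : ℂ) * (Real.fourierChar (inner ℝ (h • Γ y) z) : ℂ))‖ ≤ B * ρ * ‖w y‖ := by
    rw [integral_const_mul, norm_mul, norm_mul, Circle.norm_coe, mul_one, mul_right_comm]
    refine mul_le_mul (huB y) (hρ _ ?_) (norm_nonneg _) (mul_nonneg hB0 (norm_nonneg _))
    rw [norm_smul, Real.norm_eq_abs, abs_of_pos hh]
    exact mul_le_mul_of_nonneg_left (hK y) hh.le
  have herr := norm_integral_le_of_norm_le (hχi.mul_const _) (ae_of_all _ key)
  rw [integral_sub hi1 hi2, integral_mul_const, hχ1, one_mul] at herr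
  calc _ ≤ _ := norm_le_norm_sub_add _ _
    _ ≤ _ := add_le_add herr hmain
    _ = _ := by ring

/-- A normalized smooth bump, with the Riemann–Lebesgue lemma for its Fourier integral. The
cocompact filter is that of norms tending to infinity, so the threshold K does not depend on the
direction; no decay rate is needed. -/
theorem exists_averaging_kernel : ∃ χ : Plane → ℝ, Continuous χ ∧ Integrable χ ∧
    ∫ z, χ z = 1 ∧ (∀ z, 0 ≤ χ z) ∧ (∀ z, χ z ≠ 0 → ‖z‖ ≤ 1) ∧
    ∀ ρ : ℝ, 0 < ρ → ∃ K : ℝ, ∀ ξ : Plane, K ≤ ‖ξ‖ →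
      ‖∫ z, (χ z : ℂ) * (Real.fourierChar (inner ℝ ξ z) : ℂ)‖ ≤ ρ := by
  let φ : ContDiffBump (0 : Plane) := ⟨1 / 2, 1, by norm_num, by norm_num⟩
  refine ⟨φ.normed volume, φ.continuous_normed, φ.integrable_normed, φ.integral_normed,
    φ.nonneg_normed, fun z hz => ?_, fun ρ hρ => ?_⟩
  · have : z ∈ Function.support (φ.normed volume) := hz
    rw [φ.support_normed_eq, mem_ball_zero_iff] at this
    exact this.le
  · have h := tendsto_integral_exp_inner_smul_cocompact
      (fun z : Plane => ((φ.normed volume z : ℝ) : ℂ))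
    have h' := (Metric.tendsto_nhds.1 h) ρ hρ
    rw [← Metric.cobounded_eq_cocompact, ← comap_norm_atTop, eventually_comap] at h'
    obtain ⟨K, hK⟩ := eventually_atTop.1 h'
    refine ⟨K, fun ξ hξ => ?_⟩
    have := hK ‖-ξ‖ (by rwa [norm_neg]) (-ξ) rfl
    rw [dist_zero_right] at this
    refine le_of_eq_of_le ?_ this.le
    congr 1
    refine integral_congr_ae (ae_of_all _ fun z => ?_)
    simp only [inner_neg_right, neg_neg, Circle.smul_def, smul_eq_mul]
    rw [mul_comm, real_inner_comm]

/-! ### Uniform decay of Schwartz functions -/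

/-- The exponent 3 only has to exceed the dimension 2. -/
theorem integrable_decay (C : ℝ) : Integrable fun y : Plane => C * (1 + ‖y‖) ^ (-3 : ℝ) :=
  (integrable_one_add_norm (by simp; norm_num)).const_mul _

/-- A shift by at most 1 at worst halves 1 + ‖y‖, whence 8 = 2³. -/
theorem one_add_norm_rpow_le {y z : Plane} (hz : ‖z‖ ≤ 1) :
    (1 + ‖y + z‖) ^ (-3 : ℝ) ≤ 8 * (1 + ‖y‖) ^ (-3 : ℝ) := by
  have h1 : (1 + ‖y‖) / 2 ≤ 1 + ‖y + z‖ := by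
    have := norm_sub_le (y + z) z
    rw [add_sub_cancel_right] at this
    linarith [norm_nonneg (y + z)]
  have h2 := Real.rpow_le_rpow_of_nonpos (by positivity) h1 (by norm_num : (-3 : ℝ) ≤ 0)
  refine h2.trans (le_of_eq ?_)
  rw [Real.div_rpow (by positivity) (by norm_num), Real.rpow_neg (by norm_num : (0 : ℝ) ≤ 2)]
  norm_num
  ring

theorem exists_schwartz_bound (w : 𝓢(Plane, ℂ)) : ∃ C : ℝ, 0 < C ∧
    (∀ y, ‖w y‖ ≤ C * (1 + ‖y‖) ^ (-3 : ℝ)) ∧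
    ∀ y, ‖fderiv ℝ w y‖ ≤ C * (1 + ‖y‖) ^ (-3 : ℝ) := by
  set C := 2 ^ 3 * ((Finset.Iic (3, 1)).sup fun m => SchwartzMap.seminorm ℝ m.1 m.2) w with hC
  have hC0 : 0 ≤ C := by positivity
  have key : ∀ y : Plane, ∀ A : ℝ, (1 + ‖y‖) ^ 3 * A ≤ C → A ≤ (C + 1) * (1 + ‖y‖) ^ (-3 : ℝ) := by
    intro y A h
    have hp : (0 : ℝ) < 1 + ‖y‖ := by positivity
    rw [Real.rpow_neg hp.le, ← div_eq_mul_inv, le_div_iff₀ (by positivity), mul_comm]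
    have : (1 + ‖y‖) ^ (3 : ℝ) = (1 + ‖y‖) ^ 3 := by exact_mod_cast Real.rpow_natCast _ 3
    rw [this]
    linarith
  -- C may be zero; adding 1 gives a positive constant.
  refine ⟨C + 1, by linarith, fun y => key y _ ?_, fun y => key y _ ?_⟩
  · have := SchwartzMap.one_add_le_sup_seminorm_apply (𝕜 := ℝ) (m := (3, 1)) (k := 3) (n := 0)
      le_rfl (by norm_num) w y
    rwa [norm_iteratedFDeriv_zero] at this
  · have := SchwartzMap.one_add_le_sup_seminorm_apply (𝕜 := ℝ) (m := (3, 1)) (k := 3) (n := 1)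
      le_rfl le_rfl w y
    rwa [norm_iteratedFDeriv_one] at this

theorem norm_translate_sub_le (w : 𝓢(Plane, ℂ)) {C : ℝ}
    (hC : ∀ y, ‖fderiv ℝ w y‖ ≤ C * (1 + ‖y‖) ^ (-3 : ℝ)) (hC0 : 0 ≤ C) (y z : Plane)
    (hz : ‖z‖ ≤ 1) : ‖w (y + z) - w y‖ ≤ ‖z‖ * (8 * C * (1 + ‖y‖) ^ (-3 : ℝ)) := by
  have h := Convex.norm_image_sub_le_of_norm_fderiv_le (𝕜 := ℝ) (f := w)
    (s := Metric.closedBall y 1) (x := y) (y := y + z) (C := 8 * C * (1 + ‖y‖) ^ (-3 : ℝ))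
    (fun x _ => w.differentiableAt) (fun x hx => ?_) (convex_closedBall _ _) (by simp)
    (by simpa using hz)
  · rwa [add_sub_cancel_left, mul_comm] at h
  · rw [mem_closedBall_iff_norm] at hx
    refine (hC x).trans ?_
    have := one_add_norm_rpow_le (y := y) hx
    rw [add_sub_cancel] at this
    calc _ ≤ C * (8 * (1 + ‖y‖) ^ (-3 : ℝ)) := mul_le_mul_of_nonneg_left this hC0
      _ = _ := by ring

end CrystalSST

namespace CrystalSST

/-! ### The anisotropic dilations -/

theorem inv_rotationMatrix (θ : ℝ) :
    (rotationMatrix θ)⁻¹ = !![Real.cos θ, Real.sin θ; -Real.sin θ, Real.cos θ] := by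
  refine Matrix.inv_eq_left_inv ?_
  ext i j
  fin_cases i <;> fin_cases j <;>
    simp [rotationMatrix, Matrix.mul_apply, Fin.sum_univ_two] <;>
    nlinarith [Real.sin_sq_add_cos_sq θ]

theorem inv_scalingMatrix (s t : ℝ) {a : ℝ} (ha : 0 < a) :
    (scalingMatrix s t a)⁻¹ = !![a ^ (-t), 0; 0, a ^ (-s)] := by
  refine Matrix.inv_eq_left_inv ?_
  ext i j
  fin_cases i <;> fin_cases j <;>
    simp [scalingMatrix, Matrix.mul_apply, Fin.sum_univ_two, ← Real.rpow_add ha]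

/-- `R_θ A_a⁻¹`, the inverse of `spaceMap`. -/
def spaceInv (s t a θ : ℝ) : Plane →L[ℝ] Plane :=
  (Matrix.toEuclideanLin (rotationMatrix θ * (scalingMatrix s t a)⁻¹)).toContinuousLinearMap

theorem spaceInv_apply (s t : ℝ) {a : ℝ} (ha : 0 < a) (θ : ℝ) (y : Plane) :
    spaceInv s t a θ y = !₂[Real.cos θ * a ^ (-t) * y 0 - Real.sin θ * a ^ (-s) * y 1,
      Real.sin θ * a ^ (-t) * y 0 + Real.cos θ * a ^ (-s) * y 1] := by
  ext i
  fin_cases i <;> simp [spaceInv, Matrix.toLpLin_apply, inv_scalingMatrix s t ha, rotationMatrix,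
    dotProduct, Fin.sum_univ_two, sub_eq_add_neg]

theorem freqMap_apply (s t : ℝ) {a : ℝ} (ha : 0 < a) (θ : ℝ) (v : Plane) :
    freqMap s t a θ v = !₂[a ^ (-t) * (Real.cos θ * v 0 + Real.sin θ * v 1),
      a ^ (-s) * (-Real.sin θ * v 0 + Real.cos θ * v 1)] := by
  ext i
  fin_cases i <;> simp [freqMap, Matrix.toLpLin_apply, inv_scalingMatrix s t ha,
    inv_rotationMatrix, dotProduct, Fin.sum_univ_two] <;> ring

theorem spaceMap_apply (s t a θ : ℝ) (x : Plane) :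
    spaceMap s t a θ x = !₂[a ^ t * (Real.cos θ * x 0 + Real.sin θ * x 1),
      a ^ s * (-Real.sin θ * x 0 + Real.cos θ * x 1)] := by
  ext i
  fin_cases i <;> simp [spaceMap, Matrix.toLpLin_apply, scalingMatrix,
    inv_rotationMatrix, dotProduct, Fin.sum_univ_two] <;> ring

theorem norm_sq_rotate (θ : ℝ) (v : Plane) :
    (Real.cos θ * v 0 + Real.sin θ * v 1) ^ 2 + (-Real.sin θ * v 0 + Real.cos θ * v 1) ^ 2 =
      ‖v‖ ^ 2 := by
  rw [EuclideanSpace.norm_sq_eq, Fin.sum_univ_two, Real.norm_eq_abs, Real.norm_eq_abs, sq_abs,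
    sq_abs]
  linear_combination (v 0 ^ 2 + v 1 ^ 2) * Real.sin_sq_add_cos_sq θ

theorem norm_sq_vec2 (x y : ℝ) : ‖(!₂[x, y] : Plane)‖ ^ 2 = x ^ 2 + y ^ 2 := by
  simp [EuclideanSpace.norm_sq_eq, Fin.sum_univ_two]

theorem spaceMap_spaceInv (s t : ℝ) {a : ℝ} (ha : 0 < a) (θ : ℝ) (y : Plane) :
    spaceMap s t a θ (spaceInv s t a θ y) = y := by
  have h1 : a ^ t * a ^ (-t) = 1 := by rw [← Real.rpow_add ha]; simp
  have h2 : a ^ s * a ^ (-s) = 1 := by rw [← Real.rpow_add ha]; simp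
  have h3 := Real.sin_sq_add_cos_sq θ
  rw [spaceMap_apply, spaceInv_apply s t ha]
  ext i
  fin_cases i
  · simp
    linear_combination (y 0 * (Real.sin θ ^ 2 + Real.cos θ ^ 2)) * h1 + y 0 * h3
  · simp
    linear_combination (y 1 * (Real.sin θ ^ 2 + Real.cos θ ^ 2)) * h2 + y 1 * h3

/-- `freqMap` is the transpose of `spaceInv`, so rescaling space acts on wave vectors by `freqMap`.
-/
theorem inner_spaceInv (s t : ℝ) {a : ℝ} (ha : 0 < a) (θ : ℝ) (v y : Plane) :
    inner ℝ v (spaceInv s t a θ y) = inner ℝ (freqMap s t a θ v) y := by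
  rw [spaceInv_apply s t ha, freqMap_apply s t ha]
  simp [PiLp.inner_apply, Fin.sum_univ_two]
  ring

/-- The singular values are a^{-t} ≤ a^{-s}. The larger one governs Taylor errors, so these involve
s; the smaller one bounds `freqMap` from below, so separations of frequencies involve t. -/
theorem norm_spaceInv_le {s t a : ℝ} (hst : s ≤ t) (ha : 1 ≤ a) (θ : ℝ) (y : Plane) :
    ‖spaceInv s t a θ y‖ ≤ a ^ (-s) * ‖y‖ := by
  have ha0 : 0 < a := by linarith
  have hpos : 0 < a ^ (-s) := by positivity
  refine le_of_sq_le_sq ?_ (by positivity)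
  have h : a ^ (-t) ≤ a ^ (-s) := Real.rpow_le_rpow_of_exponent_le ha (by linarith)
  have h' : (a ^ (-t)) ^ 2 ≤ (a ^ (-s)) ^ 2 := pow_le_pow_left₀ (by positivity) h 2
  rw [spaceInv_apply s t ha0, norm_sq_vec2, mul_pow, EuclideanSpace.norm_sq_eq, Fin.sum_univ_two,
    Real.norm_eq_abs, Real.norm_eq_abs, sq_abs, sq_abs]
  have e : (Real.cos θ * a ^ (-t) * y 0 - Real.sin θ * a ^ (-s) * y 1) ^ 2 +
      (Real.sin θ * a ^ (-t) * y 0 + Real.cos θ * a ^ (-s) * y 1) ^ 2 =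
      (a ^ (-t)) ^ 2 * y 0 ^ 2 + (a ^ (-s)) ^ 2 * y 1 ^ 2 := by
    linear_combination ((a ^ (-t)) ^ 2 * y 0 ^ 2 + (a ^ (-s)) ^ 2 * y 1 ^ 2) *
      Real.sin_sq_add_cos_sq θ
  rw [e, mul_add]
  gcongr

theorem le_norm_freqMap {s t a : ℝ} (hst : s ≤ t) (ha : 1 ≤ a) (θ : ℝ) (v : Plane) :
    a ^ (-t) * ‖v‖ ≤ ‖freqMap s t a θ v‖ := by
  have ha0 : 0 < a := by linarith
  refine le_of_sq_le_sq ?_ (norm_nonneg _)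
  have h : a ^ (-t) ≤ a ^ (-s) := Real.rpow_le_rpow_of_exponent_le ha (by linarith)
  rw [freqMap_apply s t ha0, norm_sq_vec2, mul_pow, mul_pow, mul_pow, ← norm_sq_rotate θ, mul_add]
  gcongr

theorem norm_le_of_norm_freqMap_le {s t a d : ℝ} (hst : s ≤ t) (ha : 1 ≤ a) (θ : ℝ) {v : Plane}
    (h : ‖freqMap s t a θ v‖ ≤ d) : ‖v‖ ≤ a ^ t * d := by
  have ha0 : 0 < a := by linarith
  have h1 := (le_norm_freqMap hst ha θ v).trans h
  rwa [Real.rpow_neg ha0.le, ← div_eq_inv_mul, div_le_iff₀ (by positivity), mul_comm] at h1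

/-- `spaceMap` as a continuous linear map. -/
def spaceCLM (s t a θ : ℝ) : Plane →L[ℝ] Plane :=
  (Matrix.toEuclideanLin (scalingMatrix s t a * (rotationMatrix θ)⁻¹)).toContinuousLinearMap

theorem spaceCLM_apply (s t a θ : ℝ) (x : Plane) :
    spaceCLM s t a θ x = spaceMap s t a θ x := rfl

theorem norm_spaceCLM_le {s t a : ℝ} (hst : s ≤ t) (ha : 1 ≤ a) (θ : ℝ) :
    ‖spaceCLM s t a θ‖ ≤ a ^ t := by
  have ha0 : 0 < a := by linarith
  refine ContinuousLinearMap.opNorm_le_bound _ (by positivity) fun x => ?_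
  refine le_of_sq_le_sq ?_ (by positivity)
  have h : a ^ s ≤ a ^ t := Real.rpow_le_rpow_of_exponent_le ha hst
  rw [spaceCLM_apply, spaceMap_apply, norm_sq_vec2, mul_pow, mul_pow, mul_pow,
    ← norm_sq_rotate θ x, mul_add]
  gcongr

theorem norm_le_norm_spaceMap {s t a : ℝ} (hs : 0 ≤ s) (ht : 0 ≤ t) (ha : 1 ≤ a) (θ : ℝ)
    (x : Plane) : ‖x‖ ≤ ‖spaceMap s t a θ x‖ := by
  refine le_of_sq_le_sq ?_ (norm_nonneg _)
  have h1 : 1 ≤ (a ^ s) ^ 2 := one_le_pow₀ (Real.one_le_rpow ha hs)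
  have h2 : 1 ≤ (a ^ t) ^ 2 := one_le_pow₀ (Real.one_le_rpow ha ht)
  rw [spaceMap_apply, norm_sq_vec2, mul_pow, mul_pow, ← norm_sq_rotate θ x]
  exact add_le_add (le_mul_of_one_le_left (sq_nonneg _) h2)
    (le_mul_of_one_le_left (sq_nonneg _) h1)

theorem det_spaceInv (s t : ℝ) {a : ℝ} (ha : 0 < a) (θ : ℝ) :
    LinearMap.det (spaceInv s t a θ : Plane →ₗ[ℝ] Plane) = a ^ (-(t + s)) := by
  have : (spaceInv s t a θ : Plane →ₗ[ℝ] Plane) =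
      Matrix.toEuclideanLin (rotationMatrix θ * (scalingMatrix s t a)⁻¹) := rfl
  rw [this, LinearMap.det_toLpLin, Matrix.det_mul, inv_scalingMatrix s t ha, rotationMatrix,
    Matrix.det_fin_two_of, Matrix.det_fin_two_of, neg_add, Real.rpow_add ha]
  linear_combination (a ^ (-t) * a ^ (-s)) * Real.sin_sq_add_cos_sq θ

/-- Scaling of Haar measure under an invertible linear map; since that map is a measurable
embedding, no integrability of g is required. -/
theorem integral_comp_spaceInv {E : Type*} [NormedAddCommGroup E] [NormedSpace ℝ E] (s t : ℝ)
    {a : ℝ} (ha : 0 < a) (θ : ℝ) (b : Plane) (g : Plane → E) :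
    ∫ x, g x = a ^ (-(t + s)) • ∫ y, g (b + spaceInv s t a θ y) := by
  have hpos : 0 < a ^ (-(t + s)) := by positivity
  have hdet : LinearMap.det (spaceInv s t a θ : Plane →ₗ[ℝ] Plane) ≠ 0 := by
    rw [det_spaceInv s t ha]; exact hpos.ne'
  have hemb : MeasurableEmbedding (spaceInv s t a θ : Plane → Plane) :=
    ((spaceInv s t a θ : Plane →ₗ[ℝ] Plane).equivOfDetNeZero hdet
      ).toContinuousLinearEquiv.toHomeomorph.measurableEmbedding
  have h := hemb.integral_map (μ := volume) (fun y => g (b + y))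
  have hm := Measure.map_linearMap_addHaar_eq_smul_addHaar (volume : Measure Plane) hdet
  rw [ContinuousLinearMap.coe_coe, det_spaceInv s t ha] at hm
  rw [← h, hm, integral_smul_measure, ENNReal.toReal_ofReal (abs_nonneg _), abs_of_pos (by positivity),
    smul_smul, mul_inv_cancel₀ hpos.ne', one_smul, integral_add_left_eq_self g b]

end CrystalSST

namespace CrystalSST

/-! ### Decay of a single component away from its local wave vector -/

theorem norm_unitVec (θ : ℝ) : ‖unitVec θ‖ = 1 := by
  have : ‖unitVec θ‖ ^ 2 = 1 := by
    rw [unitVec, norm_sq_vec2]; exact Real.cos_sq_add_sin_sq θ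
  exact (pow_eq_one_iff_of_nonneg (norm_nonneg _) two_ne_zero).1 this

/-- The rescaled wave packet coefficient of `α(x) e^{2πi Ψ(x)}`. -/
def packetIntegral (s t : ℝ) (w : 𝓢(Plane, ℂ)) (α Ψ : Plane → ℝ) (a θ : ℝ) (b : Plane) : ℂ :=
  ∫ y, conj (w y) * ((α (b + spaceInv s t a θ y) : ℂ) *
    (Real.fourierChar (Ψ (b + spaceInv s t a θ y) -
      inner ℝ (a • unitVec θ) (spaceInv s t a θ y)) : ℂ))

/-- Bounds on the amplitude `α` and on the phase `Ψ` with gradient field `Γ` of a wave of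
frequency `Λ`. -/
structure IsWave (M Λ : ℝ) (α Ψ : Plane → ℝ) (Γ : Plane → Plane) : Prop where
  amp_cont : Continuous α
  phase_cont : Continuous Ψ
  amp_le : ∀ x, |α x| ≤ M
  amp_lip : ∀ x z, |α (x + z) - α x| ≤ M * ‖z‖
  taylor : ∀ x z, |Ψ (x + z) - Ψ x - inner ℝ (Γ x) z| ≤ Λ * M * ‖z‖ ^ 2
  grad_lower : ∀ x, Λ / M ≤ ‖Γ x‖

/-- The subtracted carrier is linear and contributes no error. By transposition the rescaled
gradient is `freqMap` of Γ − a e_θ, and each factor ‖z‖ in the remainder gains a^{-s}. -/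
theorem IsWave.taylor_comp {M Λ s t a : ℝ} {α Ψ : Plane → ℝ} {Γ : Plane → Plane}
    (h : IsWave M Λ α Ψ Γ) (hΛ : 0 ≤ Λ * M) (hst : s ≤ t) (ha : 1 ≤ a) (θ : ℝ) (b y z : Plane) :
    |(Ψ (b + spaceInv s t a θ (y + z)) -
        inner ℝ (a • unitVec θ) (spaceInv s t a θ (y + z))) -
      (Ψ (b + spaceInv s t a θ y) - inner ℝ (a • unitVec θ) (spaceInv s t a θ y)) -
      inner ℝ (freqMap s t a θ (Γ (b + spaceInv s t a θ y) - a • unitVec θ)) z| ≤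
      Λ * M * (a ^ (-s)) ^ 2 * ‖z‖ ^ 2 := by
  have ha0 : 0 < a := by linarith
  rw [← inner_spaceInv s t ha0, map_add, inner_add_right, inner_sub_left, ← add_assoc]
  have h1 := h.taylor (b + spaceInv s t a θ y) (spaceInv s t a θ z)
  have h2 := pow_le_pow_left₀ (norm_nonneg _) (norm_spaceInv_le (s := s) (t := t) hst ha θ z) 2
  calc _ = _ := by congr 1; ring
    _ ≤ _ := h1
    _ ≤ Λ * M * (a ^ (-s) * ‖z‖) ^ 2 := mul_le_mul_of_nonneg_left h2 hΛ
    _ = _ := by ring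

theorem IsWave.amp_lip_comp {M Λ s t a : ℝ} {α Ψ : Plane → ℝ} {Γ : Plane → Plane}
    (h : IsWave M Λ α Ψ Γ) (hM : 0 ≤ M) (hst : s ≤ t) (ha : 1 ≤ a) (θ : ℝ) (b y z : Plane) :
    |α (b + spaceInv s t a θ (y + z)) - α (b + spaceInv s t a θ y)| ≤ M * a ^ (-s) * ‖z‖ := by
  rw [map_add, ← add_assoc, mul_assoc]
  exact (h.amp_lip _ _).trans
    (mul_le_mul_of_nonneg_left (norm_spaceInv_le hst ha θ z) hM)

/-- Linearization at b leaves a main term containing ŵ at the given point, which vanishes. The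
errors a^{-s} and Λ a^{-2s} are O(a^{1-2s}) because Λ ≤ 2Ma, and a ≥ Λ/(2M) forces them to zero. -/
theorem exists_packetIntegral_le_of_high_scale {s t M : ℝ} (hs : 1 / 2 < s) (hst : s ≤ t)
    (ht : t < 1) (hM : 1 ≤ M) (w : 𝓢(Plane, ℂ)) {δ : ℝ} (hδ : 0 < δ) :
    ∃ Λ₀ : ℝ, ∀ Λ, Λ₀ ≤ Λ → ∀ (α Ψ : Plane → ℝ) (Γ : Plane → Plane), IsWave M Λ α Ψ Γ →
      ∀ (a θ : ℝ) (b : Plane), 1 ≤ a → Λ ≤ 2 * M * a →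
        𝓕 w (freqMap s t a θ (Γ b - a • unitVec θ)) = 0 →
        ‖packetIntegral s t w α Ψ a θ b‖ ≤ δ := by
  set J₁ := ∫ y, ‖y‖ ^ 1 * ‖w y‖ with hJ₁
  set J₂ := ∫ y, ‖y‖ ^ 2 * ‖w y‖ with hJ₂
  have hJ₁0 : 0 ≤ J₁ := integral_nonneg fun y => by positivity
  have hJ₂0 : 0 ≤ J₂ := integral_nonneg fun y => by positivity
  have hM0 : 0 < M := by linarith
  have hlim : Tendsto (fun Λ : ℝ => (M * J₁ + 2 * Real.pi * M * (2 * M * M) * J₂) *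
      (Λ / (2 * M)) ^ (-(2 * s - 1))) atTop (nhds 0) := by
    rw [← mul_zero (M * J₁ + 2 * Real.pi * M * (2 * M * M) * J₂)]
    exact ((tendsto_rpow_neg_atTop (by linarith)).comp
      (tendsto_id.atTop_div_const (by positivity))).const_mul _
  obtain ⟨Λ₀, hΛ₀⟩ := eventually_atTop.1 ((hlim.eventually_le_const hδ).and (eventually_gt_atTop 0))
  refine ⟨Λ₀, fun Λ hΛ α Ψ Γ hwave a θ b ha hΛa hzero => ?_⟩
  obtain ⟨hsmall, hΛpos⟩ := hΛ₀ Λ hΛ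
  have ha0 : 0 < a := by linarith
  have hB := norm_oscillatory_sub_fourier_le w (β := fun y => α (b + spaceInv s t a θ y))
    (G := fun y => Ψ (b + spaceInv s t a θ y) - inner ℝ (a • unitVec θ) (spaceInv s t a θ y))
    (freqMap s t a θ (Γ b - a • unitVec θ)) (B := M) (L := M * a ^ (-s))
    (H := Λ * M * (a ^ (-s)) ^ 2)
    (hwave.amp_cont.comp (by fun_prop)) ((hwave.phase_cont.comp (by fun_prop)).sub (by fun_prop))
    (fun y => hwave.amp_le _)
    (fun y => by simpa using hwave.amp_lip_comp hM0.le hst ha θ b 0 y)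
    (fun y => by simpa using hwave.taylor_comp (by positivity) hst ha θ b 0 y)
  rw [hzero, map_zero (starRingEnd ℂ), mul_zero, sub_zero] at hB
  refine (hB.trans ?_).trans hsmall
  have e1 : a ^ (-s) ≤ a ^ (-(2 * s - 1)) := Real.rpow_le_rpow_of_exponent_le ha (by linarith)
  have e2 : a * (a ^ (-s)) ^ 2 = a ^ (-(2 * s - 1)) := by
    rw [← Real.rpow_natCast, ← Real.rpow_mul ha0.le, ← Real.rpow_one_add' ha0.le (by push_cast; linarith)]
    congr 1; push_cast; ring
  have e3 : a ^ (-(2 * s - 1)) ≤ (Λ / (2 * M)) ^ (-(2 * s - 1)) :=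
    Real.rpow_le_rpow_of_nonpos (by positivity)
      ((div_le_iff₀ (by positivity)).2 (by linarith)) (by linarith)
  calc M * a ^ (-s) * J₁ + 2 * Real.pi * M * (Λ * M * (a ^ (-s)) ^ 2) * J₂
      ≤ M * a ^ (-(2 * s - 1)) * J₁ +
        2 * Real.pi * M * (2 * M * a * M * (a ^ (-s)) ^ 2) * J₂ := by gcongr
    _ = (M * J₁ + 2 * Real.pi * M * (2 * M * M) * J₂) * a ^ (-(2 * s - 1)) := by
        rw [← e2]; ring
    _ ≤ _ := by gcongr

/-- Here a is at most half of the lower bound Λ/M for the wave vector, so the phase gradient never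
falls below Λ/(2M) and averaging applies at every point. No condition on ŵ is involved. -/
theorem exists_packetIntegral_le_of_low_scale {s t M : ℝ} (hs : 1 / 2 < s) (hst : s ≤ t)
    (ht : t < 1) (hM : 1 ≤ M) (w : 𝓢(Plane, ℂ)) {δ : ℝ} (hδ : 0 < δ) :
    ∃ Λ₀ : ℝ, ∀ Λ, Λ₀ ≤ Λ → ∀ (α Ψ : Plane → ℝ) (Γ : Plane → Plane), IsWave M Λ α Ψ Γ →
      ∀ (a θ : ℝ) (b : Plane), 1 ≤ a → 2 * M * a ≤ Λ →
        ‖packetIntegral s t w α Ψ a θ b‖ ≤ δ := by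
  obtain ⟨C, hC0, -, hC⟩ := exists_schwartz_bound w
  obtain ⟨χ, hχc, hχi, hχ1, hχ0, hχs, hχρ⟩ := exists_averaging_kernel
  set g : Plane → ℝ := fun y => 8 * C * (1 + ‖y‖) ^ (-3 : ℝ) with hg
  have hgi : Integrable g := integrable_decay _
  set Jg := ∫ y, g y with hJg
  set J₀ := ∫ y, ‖w y‖ with hJ₀
  have hJg0 : 0 ≤ Jg := integral_nonneg fun y => by positivity
  have hJ₀0 : 0 ≤ J₀ := integral_nonneg fun y => by positivity
  have hM0 : 0 < M := by linarith
  -- Chosen so that the Riemann–Lebesgue term M ρ J₀ is at most δ/2.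
  set ρ := δ / (2 * (M * J₀ + 1)) with hρ
  have hρ0 : 0 < ρ := by positivity
  obtain ⟨K₀, hK₀⟩ := hχρ ρ hρ0
  set κ := (1 - t) / 2 with hκ
  have hκ0 : 0 < κ := by rw [hκ]; linarith
  have hlim : Tendsto (fun Λ : ℝ => (M * Jg + M * J₀) * Λ ^ (-κ) +
      M * (2 * Real.pi * M) * J₀ * Λ ^ (-(2 * s - 1))) atTop (nhds 0) := by
    have := ((tendsto_rpow_neg_atTop hκ0).const_mul (M * Jg + M * J₀)).add
      ((tendsto_rpow_neg_atTop (by linarith : 0 < 2 * s - 1)).const_mul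
        (M * (2 * Real.pi * M) * J₀))
    simpa using this
  have hlim2 : Tendsto (fun Λ : ℝ => Λ ^ κ / (2 * M)) atTop atTop :=
    (tendsto_rpow_atTop hκ0).atTop_div_const (by positivity)
  obtain ⟨Λ₀, hΛ₀⟩ := eventually_atTop.1 (((hlim.eventually_le_const (half_pos hδ)).and
    (hlim2.eventually_ge_atTop K₀)).and (eventually_ge_atTop 1))
  refine ⟨Λ₀, fun Λ hΛ α Ψ Γ hwave a θ b ha hΛa => ?_⟩
  obtain ⟨⟨hsmall, hlarge⟩, hΛ1⟩ := hΛ₀ Λ hΛ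
  have hΛ0 : 0 < Λ := by linarith
  have ha0 : 0 < a := by linarith
  have haΛ : a ≤ Λ := by nlinarith
  have ht0 : 0 ≤ t := by linarith
  -- The averaging radius balances three demands: h ≤ Λ^{-κ} tends to 0; h a^{-t} Λ = Λ^κ tends to
  -- infinity, so the average still sees many oscillations; and the curvature error Λ a^{-2s} h² is
  -- at most Λ^{t-2s} ≤ Λ^{1-2s}.
  set h := a ^ t * Λ ^ (-1 + κ) with hh
  have hh0 : 0 < h := by positivity
  have hhle : h ≤ Λ ^ (-κ) := by
    calc h ≤ Λ ^ t * Λ ^ (-1 + κ) := by rw [hh]; gcongr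
      _ = Λ ^ (-κ) := by rw [← Real.rpow_add hΛ0]; congr 1; rw [hκ]; ring
  have hhle1 : h ≤ 1 := hhle.trans (Real.rpow_le_one_of_one_le_of_nonpos hΛ1 (by linarith))
  have hHh : Λ * M * (a ^ (-s)) ^ 2 * h ^ 2 ≤ M * Λ ^ (-(2 * s - 1)) := by
    have e1 : Λ * M * (a ^ (-s)) ^ 2 * h ^ 2 = M * ((a ^ (t - s)) ^ 2 * (Λ * (Λ ^ (-1 + κ)) ^ 2)) := by
      rw [sub_eq_add_neg, Real.rpow_add ha0, hh]; ring
    have e2 : (Λ ^ (t - s)) ^ 2 * (Λ * (Λ ^ (-1 + κ)) ^ 2) = Λ ^ (t - 2 * s) := by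
      rw [← Real.rpow_natCast, ← Real.rpow_natCast, ← Real.rpow_mul hΛ0.le,
        ← Real.rpow_mul hΛ0.le]
      nth_rewrite 2 [← Real.rpow_one Λ]
      rw [← Real.rpow_add hΛ0, ← Real.rpow_add hΛ0]
      congr 1; rw [hκ]; push_cast; ring
    rw [e1]
    refine mul_le_mul_of_nonneg_left ?_ hM0.le
    calc _ ≤ (Λ ^ (t - s)) ^ 2 * (Λ * (Λ ^ (-1 + κ)) ^ 2) := by
          have : a ^ (t - s) ≤ Λ ^ (t - s) := Real.rpow_le_rpow ha0.le haΛ (by linarith)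
          gcongr
      _ = Λ ^ (t - 2 * s) := e2
      _ ≤ _ := Real.rpow_le_rpow_of_exponent_le hΛ1 (by linarith)
  have hB := norm_oscillatory_le w (β := fun y => α (b + spaceInv s t a θ y))
    (G := fun y => Ψ (b + spaceInv s t a θ y) - inner ℝ (a • unitVec θ) (spaceInv s t a θ y))
    (fun y => freqMap s t a θ (Γ (b + spaceInv s t a θ y) - a • unitVec θ)) (χ := χ) (g := g)
    (B := M) (L := M) (H := Λ * M * (a ^ (-s)) ^ 2) (h := h) (K := a ^ (-t) * (Λ / (2 * M)))
    (ρ := ρ) (hwave.amp_cont.comp (by fun_prop))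
    ((hwave.phase_cont.comp (by fun_prop)).sub (by fun_prop)) (fun y => hwave.amp_le _)
    (fun y z => by
      refine (hwave.amp_lip_comp hM0.le hst ha θ b y z).trans ?_
      gcongr
      exact mul_le_of_le_one_right hM0.le (Real.rpow_le_one_of_one_le_of_nonpos ha (by linarith)))
    (fun y z => hwave.taylor_comp (by positivity) hst ha θ b y z)
    (fun y => by
      refine le_trans ?_ (le_norm_freqMap hst ha θ _)
      gcongr
      have h1 := norm_sub_norm_le (Γ (b + spaceInv s t a θ y)) (a • unitVec θ)
      rw [norm_smul, norm_unitVec, Real.norm_eq_abs, abs_of_pos ha0, mul_one] at h1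
      have h2 := hwave.grad_lower (b + spaceInv s t a θ y)
      have h3 : a ≤ Λ / (2 * M) := (le_div_iff₀ (by positivity)).2 (by linarith)
      have h4 : Λ / M = Λ / (2 * M) + Λ / (2 * M) := by field_simp; ring
      linarith)
    hM0.le (by positivity) hh0 hhle1 hχc hχi hχ1 hχ0 hχs
    (fun ξ hξ => hK₀ ξ (by
      refine (hlarge.trans (le_of_eq ?_)).trans hξ
      rw [hh, Real.rpow_add hΛ0, Real.rpow_neg ha0.le, Real.rpow_neg_one]
      field_simp))
    hgi (fun y z hz => norm_translate_sub_le w hC hC0.le y z hz)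
  refine hB.trans ?_
  have hρJ : M * ρ * J₀ ≤ δ / 2 := by
    rw [hρ, mul_div_assoc', div_mul_eq_mul_div, div_le_div_iff₀ (by positivity) (by norm_num)]
    nlinarith
  calc M * h * Jg + (M * h + M * (2 * Real.pi * (Λ * M * (a ^ (-s)) ^ 2 * h ^ 2)) + M * ρ) * J₀
      ≤ M * Λ ^ (-κ) * Jg + (M * Λ ^ (-κ) + M * (2 * Real.pi * (M * Λ ^ (-(2 * s - 1)))) +
        M * ρ) * J₀ := by gcongr
    _ = ((M * Jg + M * J₀) * Λ ^ (-κ) + M * (2 * Real.pi * M) * J₀ * Λ ^ (-(2 * s - 1))) +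
        M * ρ * J₀ := by ring
    _ ≤ δ / 2 + δ / 2 := add_le_add hsmall hρJ
    _ = δ := by ring

theorem exists_packetIntegral_le {s t M : ℝ} (hs : 1 / 2 < s) (hst : s ≤ t)
    (ht : t < 1) (hM : 1 ≤ M) (w : 𝓢(Plane, ℂ)) {δ : ℝ} (hδ : 0 < δ) :
    ∃ Λ₀ : ℝ, ∀ Λ, Λ₀ ≤ Λ → ∀ (α Ψ : Plane → ℝ) (Γ : Plane → Plane), IsWave M Λ α Ψ Γ →
      ∀ (a θ : ℝ) (b : Plane), 1 ≤ a → 𝓕 w (freqMap s t a θ (Γ b - a • unitVec θ)) = 0 →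
        ‖packetIntegral s t w α Ψ a θ b‖ ≤ δ := by
  obtain ⟨Λ₁, h₁⟩ := exists_packetIntegral_le_of_high_scale hs hst ht hM w hδ
  obtain ⟨Λ₂, h₂⟩ := exists_packetIntegral_le_of_low_scale hs hst ht hM w hδ
  refine ⟨max Λ₁ Λ₂, fun Λ hΛ α Ψ Γ hwave a θ b ha hzero => ?_⟩
  rcases le_total Λ (2 * M * a) with h | h
  · exact h₁ Λ ((le_max_left _ _).trans hΛ) α Ψ Γ hwave a θ b ha h hzero
  · exact h₂ Λ ((le_max_right _ _).trans hΛ) α Ψ Γ hwave a θ b ha h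

end CrystalSST

namespace CrystalSST

/-! ### Components of an intrinsic mode type function -/

theorem norm_gradient (f : Plane → ℝ) (x : Plane) : ‖gradient f x‖ = ‖fderiv ℝ f x‖ :=
  LinearIsometryEquiv.norm_map _ _

theorem gradient_const_mul {f : Plane → ℝ} (hf : Differentiable ℝ f) (c : ℝ) (x : Plane) :
    gradient (fun y => c * f y) x = c • gradient f x := by
  refine ext_inner_right ℝ fun v => ?_
  rw [inner_gradient_left, fderiv_const_mul (hf x), real_inner_smul_left, inner_gradient_left]
  rfl

theorem differentiable_gradient {f : Plane → ℝ} (hf : ContDiff ℝ ∞ f) :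
    Differentiable ℝ (gradient f) := by
  rw [differentiable_euclidean]
  intro i
  have h : (fun x => (gradient f x).ofLp i) = fun x => fderiv ℝ f x (EuclideanSpace.single i 1) := by
    ext x
    rw [← inner_gradient_left, EuclideanSpace.inner_single_right]
    simp
  rw [h]
  exact ((hf.fderiv_right (m := 1) (by norm_cast)).differentiable one_ne_zero).clm_apply
    (differentiable_const _)

/-- Mean value inequality for f minus its differential at x, on the ball of radius ‖z‖. The usual
factor 1/2 is lost, harmlessly. -/
theorem taylor_bound {f : Plane → ℝ} {B : ℝ} (hf : ContDiff ℝ ∞ f)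
    (hB : ∀ x, ‖fderiv ℝ (gradient f) x‖ ≤ B) (x z : Plane) :
    |f (x + z) - f x - inner ℝ (gradient f x) z| ≤ B * ‖z‖ ^ 2 := by
  have hB0 : 0 ≤ B := (norm_nonneg _).trans (hB 0)
  have hfd : Differentiable ℝ f := hf.differentiable (by simp)
  have hgrad : ∀ u, ‖gradient f u - gradient f x‖ ≤ B * ‖u - x‖ := fun u =>
    Convex.norm_image_sub_le_of_norm_fderiv_le (𝕜 := ℝ) (s := univ)
      (fun y _ => differentiable_gradient hf y) (fun y _ => hB y) convex_univ (mem_univ _)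
      (mem_univ _)
  have hder : ∀ u, HasFDerivAt (fun u => f u - fderiv ℝ f x u) (fderiv ℝ f u - fderiv ℝ f x) u :=
    fun u => (hfd u).hasFDerivAt.sub (fderiv ℝ f x).hasFDerivAt
  have h := Convex.norm_image_sub_le_of_norm_hasFDerivWithin_le (𝕜 := ℝ)
    (s := Metric.closedBall x ‖z‖) (C := B * ‖z‖) (x := x) (y := x + z)
    (fun u _ => (hder u).hasFDerivWithinAt) (fun u hu => ?_) (convex_closedBall _ _)
    (by simp) (by simp)
  · rw [add_sub_cancel_left, Real.norm_eq_abs, map_add] at h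
    rw [inner_gradient_left]
    calc _ = _ := by congr 1; ring
      _ ≤ _ := h
      _ = _ := by ring
  · have e : fderiv ℝ f u - fderiv ℝ f x =
        InnerProductSpace.toDual ℝ Plane (gradient f u - gradient f x) := by
      rw [map_sub, toDual_gradient, toDual_gradient]
    rw [e, LinearIsometryEquiv.norm_map]
    refine (hgrad u).trans (mul_le_mul_of_nonneg_left ?_ hB0)
    rwa [mem_closedBall_iff_norm] at hu

theorem rowVec_sub (F : Matrix (Fin 2) (Fin 2) ℝ) (n m : Fin 2 → ℤ) :
    rowVec F (n - m) = rowVec F n - rowVec F m := by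
  ext i
  simp [rowVec, Matrix.vecMul, dotProduct, Fin.sum_univ_two]
  ring

theorem contDiff_phase (F : Matrix (Fin 2) (Fin 2) ℝ) {φ : Plane → Plane} (hφ : ContDiff ℝ ∞ φ)
    (n : Fin 2 → ℤ) : ContDiff ℝ ∞ (phase F φ n) :=
  contDiff_const.inner ℝ hφ

theorem gradient_phase_sub (F : Matrix (Fin 2) (Fin 2) ℝ) {φ : Plane → Plane}
    (hφ : ContDiff ℝ ∞ φ) (n m : Fin 2 → ℤ) (x : Plane) :
    gradient (phase F φ (n - m)) x = gradient (phase F φ n) x - gradient (phase F φ m) x := by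
  have hd : ∀ k, Differentiable ℝ (phase F φ k) := fun k =>
    (contDiff_phase F hφ k).differentiable (by simp)
  have h : phase F φ (n - m) = phase F φ n - phase F φ m := by
    ext y; simp [phase, rowVec_sub, inner_sub_left]
  refine ext_inner_right ℝ fun v => ?_
  rw [inner_sub_left, inner_gradient_left, inner_gradient_left, inner_gradient_left, h,
    fderiv_sub (hd n x) (hd m x)]
  rfl

theorem gradient_phase {F : Matrix (Fin 2) (Fin 2) ℝ} {φ : Plane → Plane}
    (hφ : ContDiff ℝ ∞ φ) {n : Fin 2 → ℤ} (hn : 0 < ‖rowVec F n‖) (x : Plane) :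
    gradient (phase F φ n) x = ‖rowVec F n‖ • gradient (normPhase F φ n) x := by
  have hd : Differentiable ℝ (normPhase F φ n) :=
    ContDiff.differentiable ((contDiff_phase F hφ n).div_const _) (by simp)
  rw [← gradient_const_mul hd]
  congr 1
  ext y
  rw [normPhase, mul_div_cancel₀ _ hn.ne']

variable {M N : ℝ} {F : Matrix (Fin 2) (Fin 2) ℝ} {α : Plane → ℝ} {S : Plane → ℂ}
  {φ : Plane → Plane} {f : Plane → ℂ}

theorem IsShapeFunction.ne_zero_of_mem (h : IsShapeFunction M S) {n : Fin 2 → ℤ}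
    (hn : n ∈ spectrum2 S) : n ≠ 0 := fun h0 => hn (h0 ▸ h.mean_zero)

theorem IsGIMT.one_le (h : IsGIMT M N F α S φ f) (hM : 0 < M) : 1 ≤ M := by
  have h1 := (h.amp_lower 0).trans (h.amp_upper 0)
  rw [div_le_iff₀ hM] at h1
  nlinarith

theorem IsGIMT.abs_amp_le (h : IsGIMT M N F α S φ f) (hM : 0 < M) (x : Plane) : |α x| ≤ M := by
  have : 0 < 1 / M := by positivity
  rw [abs_of_pos (this.trans_le (h.amp_lower x))]
  exact h.amp_upper x

/-- The hypotheses concern normalized phases, so multiplying by Λ = N|nᵀF| restores the true one. As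
Λ ≥ N, a threshold on Λ is a threshold on N valid for every n at once. -/
theorem IsGIMT.isWave (h : IsGIMT M N F α S φ f) (hM : 0 < M) (hN : 0 ≤ N) {n : Fin 2 → ℤ}
    (hn : n ∈ spectrum2 S) (hF : 1 ≤ ‖rowVec F n‖) :
    IsWave M (N * ‖rowVec F n‖) α (fun x => N * phase F φ n x) (localWaveVector N F φ n) where
  amp_cont := h.amp_smooth.continuous
  phase_cont := (contDiff_phase F h.phase_smooth n).continuous.const_mul N
  amp_le := h.abs_amp_le hM
  amp_lip x z := by
    have := Convex.norm_image_sub_le_of_norm_fderiv_le (𝕜 := ℝ) (s := univ) (f := α) (C := M)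
      (x := x) (y := x + z)
      (fun y _ => h.amp_smooth.differentiable (by simp) y)
      (fun y _ => norm_gradient α y ▸ h.amp_grad y) convex_univ (mem_univ _) (mem_univ _)
    rwa [add_sub_cancel_left] at this
  taylor x z := by
    have hF0 : 0 < ‖rowVec F n‖ := by linarith
    have hsm : ContDiff ℝ ∞ (normPhase F φ n) := (contDiff_phase F h.phase_smooth n).div_const _
    have h1 := taylor_bound hsm (h.hess_upper n hn) x z
    have e : ∀ y, phase F φ n y = ‖rowVec F n‖ * normPhase F φ n y := fun y => by
      rw [normPhase, mul_div_cancel₀ _ hF0.ne']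
    rw [localWaveVector, gradient_phase h.phase_smooth hF0, e, e, smul_smul, real_inner_smul_left,
      ← mul_assoc, ← mul_assoc, ← mul_sub, ← mul_sub, abs_mul, abs_of_nonneg (by positivity),
      mul_assoc (N * _)]
    exact mul_le_mul_of_nonneg_left h1 (by positivity)
  grad_lower x := by
    have hF0 : 0 < ‖rowVec F n‖ := by linarith
    rw [localWaveVector, gradient_phase h.phase_smooth hF0, smul_smul, norm_smul, Real.norm_eq_abs,
      abs_of_nonneg (by positivity), div_eq_mul_one_div]
    exact mul_le_mul_of_nonneg_left (h.grad_lower n hn x) (by positivity)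

theorem IsGIMT.norm_localWaveVector_sub_ge (h : IsGIMT M N F α S φ f) (hN : 0 ≤ N)
    {n m : Fin 2 → ℤ} (hn : n ∈ spectrum2 S) (hm : m ∈ spectrum2 S) (hnm : n ≠ m)
    (hF : 1 ≤ ‖rowVec F (n - m)‖) (x : Plane) :
    N / M ≤ ‖localWaveVector N F φ n x - localWaveVector N F φ m x‖ := by
  rw [localWaveVector, localWaveVector, ← smul_sub, ← gradient_phase_sub F h.phase_smooth,
    gradient_phase h.phase_smooth (by linarith), norm_smul, norm_smul, norm_norm,
    Real.norm_eq_abs, abs_of_nonneg hN, div_eq_mul_one_div]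
  refine mul_le_mul_of_nonneg_left ?_ hN
  exact (h.grad_sep n hn m hm hnm x).trans (le_mul_of_one_le_left (norm_nonneg _) hF)

theorem intDot_smul_toEuclideanLin (F : Matrix (Fin 2) (Fin 2) ℝ) (c : ℝ) (n : Fin 2 → ℤ)
    (v : Plane) : intDot n (c • Matrix.toEuclideanLin F v) = c * inner ℝ (rowVec F n) v := by
  simp [intDot, rowVec, Matrix.toLpLin_apply, Matrix.vecMul, dotProduct, Fin.sum_univ_two,
    PiLp.inner_apply]
  ring

/-! ### Expansion of the transform over the spectrum of the shape function -/

theorem IsGIMT.hasSum (h : IsGIMT M N F α S φ f) (x : Plane) :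
    HasSum (fun n => fourierCoeff2 S n *
      ((α x : ℂ) * (Real.fourierChar (N * phase F φ n x) : ℂ))) (f x) := by
  have h1 : HasSum (fun n => fourierCoeff2 S n *
      Complex.exp (Complex.I * (intDot n ((2 * Real.pi * N) • Matrix.toEuclideanLin F (φ x)) : ℂ)))
      (S ((2 * Real.pi * N) • Matrix.toEuclideanLin F (φ x))) := h.shape.series.tendsto_at _
  rw [h.eq x]
  refine (h1.mul_left (α x : ℂ)).congr_fun fun n => ?_
  rw [Real.fourierChar_apply, intDot_smul_toEuclideanLin, phase, mul_left_comm]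
  congr 3
  push_cast
  ring

theorem IsGIMT.norm_le (h : IsGIMT M N F α S φ f) (hM : 0 < M) (x : Plane) : ‖f x‖ ≤ M * M := by
  rw [h.eq x, norm_mul, Complex.norm_real]
  exact mul_le_mul (h.abs_amp_le hM x) (h.shape.norm_sup _) (norm_nonneg _) hM.le

theorem IsGIMT.continuous (h : IsGIMT M N F α S φ f) : Continuous f := by
  have hS : Continuous S := by
    refine h.shape.series.continuous (Frequently.of_forall fun A => ?_)
    unfold intDot
    fun_prop
  have hα := h.amp_smooth.continuous
  have hφ := h.phase_smooth.continuous
  have hL : Continuous fun x : Plane => Matrix.toEuclideanLin F x :=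
    (Matrix.toEuclideanLin F).continuous_of_finiteDimensional
  have hsm : Continuous fun x : Plane => (2 * Real.pi * N) • x := continuous_const_smul _
  have : f = fun x => (α x : ℂ) * S ((2 * Real.pi * N) • Matrix.toEuclideanLin F (φ x)) :=
    funext h.eq
  rw [this]
  exact (Complex.continuous_ofReal.comp hα).mul (hS.comp (hsm.comp (hL.comp hφ)))

theorem conj_wavePacket (s t : ℝ) (w : 𝓢(Plane, ℂ)) (a θ : ℝ) (b x : Plane) :
    conj (wavePacket s t w a θ b x) = ((a ^ ((t + s) / 2) : ℝ) : ℂ) *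
      ((Real.fourierChar (-inner ℝ (a • unitVec θ) (x - b)) : ℂ) *
        conj (w (spaceMap s t a θ (x - b)))) := by
  rw [wavePacket, map_mul, map_mul, Complex.conj_ofReal, ← Complex.exp_conj, mul_assoc,
    Real.fourierChar_apply, real_inner_smul_left, real_inner_comm]
  congr 3
  simp only [map_mul, Complex.conj_I, Complex.conj_ofReal, map_ofNat]
  push_cast
  ring

/-- The Jacobian a^{-(t+s)} times the normalization a^{(t+s)/2} is exactly the weight in R_ε, so R_ε
means that the remaining integral has modulus at least √ε. -/
theorem transform_eq (s t : ℝ) (w : 𝓢(Plane, ℂ)) (f : Plane → ℂ) {a : ℝ} (ha : 0 < a) (θ : ℝ)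
    (b : Plane) : transform s t w f a θ b = ((a ^ (-((s + t) / 2)) : ℝ) : ℂ) *
      ∫ y, conj (w y) * ((Real.fourierChar (-inner ℝ (a • unitVec θ) (spaceInv s t a θ y)) : ℂ) *
        f (b + spaceInv s t a θ y)) := by
  rw [transform, integral_comp_spaceInv s t ha θ b]
  simp_rw [conj_wavePacket, add_sub_cancel_left, spaceMap_spaceInv s t ha]
  rw [← integral_smul, ← integral_const_mul]
  refine integral_congr_ae (ae_of_all _ fun y => ?_)
  have e : a ^ (-((s + t) / 2)) = a ^ (-(t + s)) * a ^ ((t + s) / 2) := by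
    rw [← Real.rpow_add ha]; congr 1; ring
  simp only [e, Complex.real_smul]
  push_cast
  ring

/-- Sum and integral may be exchanged because the L¹ norm of the n-th term is |Ŝ(n)| times a
quantity independent of n. -/
theorem IsGIMT.hasSum_integral (h : IsGIMT M N F α S φ f) (hM : 0 < M) (s t : ℝ)
    (w : 𝓢(Plane, ℂ)) (a θ : ℝ) (b : Plane) :
    HasSum (fun n => fourierCoeff2 S n *
        packetIntegral s t w α (fun x => N * phase F φ n x) a θ b)
      (∫ y, conj (w y) * ((Real.fourierChar (-inner ℝ (a • unitVec θ) (spaceInv s t a θ y)) : ℂ) *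
        f (b + spaceInv s t a θ y))) := by
  have hα := h.amp_smooth.continuous
  have hph := fun n => (contDiff_phase F h.phase_smooth n).continuous
  set u : (Fin 2 → ℤ) → Plane → ℂ := fun n y => fourierCoeff2 S n *
    (conj (w y) * ((α (b + spaceInv s t a θ y) : ℂ) *
    (Real.fourierChar (N * phase F φ n (b + spaceInv s t a θ y) -
      inner ℝ (a • unitVec θ) (spaceInv s t a θ y)) : ℂ))) with hu
  have hint : ∀ n, Integrable (u n) := fun n => by
    refine (integrable_oscillatory w (β := fun y => α (b + spaceInv s t a θ y))
      (G := fun y => N * phase F φ n (b + spaceInv s t a θ y) -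
      inner ℝ (a • unitVec θ) (spaceInv s t a θ y)) (hα.comp (by fun_prop)) ?_
      fun y => h.abs_amp_le hM _).const_mul _
    exact (((hph n).comp (by fun_prop)).const_mul N).sub (by fun_prop)
  have hnorm : (fun n => ∫ y, ‖u n y‖) = fun n => ‖fourierCoeff2 S n‖ *
      ∫ y, ‖w y‖ * ‖α (b + spaceInv s t a θ y)‖ := by
    ext n
    rw [← integral_const_mul]
    refine integral_congr_ae (ae_of_all _ fun y => ?_)
    simp only [hu, norm_mul, Circle.norm_coe, RCLike.norm_conj, Complex.norm_real, mul_one]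
  have hs := hasSum_integral_of_summable_integral_norm hint
    (hnorm ▸ h.shape.summable.mul_right _)
  have e1 : (fun n => ∫ y, u n y) = fun n => fourierCoeff2 S n *
      packetIntegral s t w α (fun x => N * phase F φ n x) a θ b :=
    funext fun n => integral_const_mul _ _
  have e2 : ∫ y, ∑' n, u n y =
      ∫ y, conj (w y) * ((Real.fourierChar (-inner ℝ (a • unitVec θ) (spaceInv s t a θ y)) : ℂ) *
        f (b + spaceInv s t a θ y)) := by
    refine integral_congr_ae (ae_of_all _ fun y => ?_)
    have h1 := ((h.hasSum (b + spaceInv s t a θ y)).mul_left (conj (w y) *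
      (Real.fourierChar (-inner ℝ (a • unitVec θ) (spaceInv s t a θ y)) : ℂ))).tsum_eq
    simp only
    rw [← mul_assoc, ← h1]
    refine tsum_congr fun n => ?_
    simp only [hu, sub_eq_add_neg, AddChar.map_add_eq_mul, Circle.coe_mul]
    ring
  rwa [e1, e2] at hs

theorem IsGIMT.norm_transform_le (h : IsGIMT M N F α S φ f) (hM : 0 < M) {s t : ℝ}
    {w : 𝓢(Plane, ℂ)} {a θ δ : ℝ} {b : Plane} (ha : 0 < a) (hδ : 0 ≤ δ)
    (hp : ∀ n ∈ spectrum2 S, ‖packetIntegral s t w α (fun x => N * phase F φ n x) a θ b‖ ≤ δ) :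
    ‖transform s t w f a θ b‖ ≤ a ^ (-((s + t) / 2)) * (M * δ) := by
  rw [transform_eq s t w f ha, norm_mul, Complex.norm_real, Real.norm_eq_abs,
    abs_of_pos (by positivity)]
  refine mul_le_mul_of_nonneg_left ?_ (by positivity)
  rw [← (h.hasSum_integral hM s t w a θ b).tsum_eq]
  refine (tsum_of_norm_bounded (h.shape.summable.hasSum.mul_right δ) fun n => ?_).trans
    (mul_le_mul_of_nonneg_right h.shape.tsum_le hδ)
  rw [norm_mul]
  by_cases hn : n ∈ spectrum2 S
  · exact mul_le_mul_of_nonneg_left (hp n hn) (norm_nonneg _)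
  · have : fourierCoeff2 S n = 0 := not_not.1 hn
    simp [this]

theorem IsMotherWavePacket.fourier_eq_zero {s t d : ℝ} {w : 𝓢(Plane, ℂ)}
    (hw : IsMotherWavePacket s t d w) {ξ : Plane} (hξ : d < ‖ξ‖) : 𝓕 w ξ = 0 := by
  by_contra hne
  have : ξ ∈ tsupport (fun ξ : Plane => 𝓕 w ξ) := subset_tsupport _ hne
  rw [hw.support_eq, mem_closedBall_zero_iff] at this
  exact absurd this (not_le.2 hξ)

theorem freqMap_neg (s t a θ : ℝ) (v : Plane) : freqMap s t a θ (-v) = -freqMap s t a θ v :=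
  map_neg _ _

/-- `R_ε` is covered by the zones `Z_n` when `N` is large. -/
theorem exists_setR_subset {s t d M : ℝ} (hs : 1 / 2 < s) (hst : s ≤ t) (ht : t < 1)
    (hM : 0 < M) {w : 𝓢(Plane, ℂ)} (hw : IsMotherWavePacket s t d w) (r : ℝ) {ε : ℝ}
    (hε : 0 < ε) : ∃ N₀ : ℝ, ∀ N, N₀ ≤ N → 0 ≤ N → ∀ F : Matrix (Fin 2) (Fin 2) ℝ,
      (∀ n : Fin 2 → ℤ, n ≠ 0 → 1 ≤ ‖rowVec F n‖) → ∀ α S φ f, IsGIMT M N F α S φ f →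
        setR s t w M N r ε f ⊆ ⋃ n ∈ spectrum2 S, setZ s t d M N r F φ n := by
  -- The bounds 1/M ≤ α ≤ M leave no such function when M < 1.
  by_cases hM1 : 1 ≤ M
  swap
  · exact ⟨0, fun N _ _ F _ α S φ f h => absurd (h.one_le hM) hM1⟩
  have hsq : 0 < √ε := Real.sqrt_pos.2 hε
  -- With Σ|Ŝ(n)| ≤ M the components then add up to at most √ε/2, strictly below the threshold.
  have hδ : 0 < √ε / (2 * M) := by positivity
  obtain ⟨N₀, hN₀⟩ := exists_packetIntegral_le hs hst ht hM1 w hδ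
  refine ⟨N₀, fun N hN hN0 F hF α S φ f h p hp => ?_⟩
  obtain ⟨a, θ, b⟩ := p
  obtain ⟨hdom, hR⟩ := hp
  have ha : 1 ≤ a := hdom.1
  have ha0 : 0 < a := by linarith
  simp only at hR
  by_contra hcon
  simp only [mem_iUnion, not_exists] at hcon
  have hle := h.norm_transform_le hM (s := s) (t := t) (w := w) (θ := θ) (b := b) ha0 hδ.le
    fun n hn => by
      have hFn := hF n (h.shape.ne_zero_of_mem hn)
      refine hN₀ (N * ‖rowVec F n‖) (hN.trans (le_mul_of_one_le_right hN0 hFn)) _ _ _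
        (h.isWave hM hN0 hn hFn) a θ b ha (hw.fourier_eq_zero ?_)
      by_contra! hle
      refine hcon n hn ⟨hdom, ?_⟩
      rw [← neg_sub, freqMap_neg, norm_neg]
      exact hle
  have hpos : 0 < a ^ (-((s + t) / 2)) := by positivity
  have e : M * (√ε / (2 * M)) = √ε / 2 := by field_simp
  rw [e] at hle
  have := le_of_mul_le_mul_left (hR.trans hle) hpos
  linarith

/-- The zones `Z_n` are pairwise disjoint when `N` is large. -/
theorem exists_setZ_disjoint {s t d M r : ℝ} (hs : 1 / 2 < s) (hst : s ≤ t) (ht : t < 1)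
    (hd1 : d ≤ 1) (hM : 0 < M) (hr : 0 < r) :
    ∃ N₀ : ℝ, ∀ N, N₀ ≤ N → 0 ≤ N → ∀ F : Matrix (Fin 2) (Fin 2) ℝ,
      (∀ n : Fin 2 → ℤ, n ≠ 0 → 1 ≤ ‖rowVec F n‖) → ∀ α S φ f, IsGIMT M N F α S φ f →
        (spectrum2 S).PairwiseDisjoint (setZ s t d M N r F φ) := by
  -- A common point of two zones would give N/M ≤ 2a^t ≤ 2(2MNr)^t; the function here is the ratio
  -- of the two ends.
  have hlim : Tendsto (fun N : ℝ => 2 * (2 * M * r) ^ t * M * N ^ (-(1 - t))) atTop (nhds 0) := by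
    simpa using (tendsto_rpow_neg_atTop (by linarith : 0 < 1 - t)).const_mul
      (2 * (2 * M * r) ^ t * M)
  obtain ⟨N₀, hN₀⟩ := eventually_atTop.1
    ((hlim.eventually_lt_const one_pos).and (eventually_gt_atTop 0))
  refine ⟨N₀, fun N hN _ F hF α S φ f h n hn m hm hnm => ?_⟩
  obtain ⟨hsmall, hN0⟩ := hN₀ N hN
  rw [Function.onFun, disjoint_left]
  rintro ⟨a, θ, b⟩ ⟨hdom, h1⟩ ⟨-, h2⟩
  have ha : 1 ≤ a := hdom.1
  have haL : a ≤ 2 * M * N * r := hdom.2.1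
  simp only at h1 h2
  have k1 := norm_le_of_norm_freqMap_le hst ha θ h1
  have k2 := norm_le_of_norm_freqMap_le hst ha θ h2
  have hsep := h.norm_localWaveVector_sub_ge hN0.le hn hm hnm (hF _ (sub_ne_zero.2 hnm)) b
  have htri : ‖localWaveVector N F φ n b - localWaveVector N F φ m b‖ ≤ 2 * a ^ t := by
    have e : localWaveVector N F φ n b - localWaveVector N F φ m b =
        (a • unitVec θ - localWaveVector N F φ m b) -
          (a • unitVec θ - localWaveVector N F φ n b) := by abel
    have hat : a ^ t * d ≤ a ^ t := mul_le_of_le_one_right (by positivity) hd1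
    rw [e]
    exact (norm_sub_le _ _).trans (by linarith)
  have hat : a ^ t ≤ (2 * M * r) ^ t * N ^ t := by
    rw [← Real.mul_rpow (by positivity) hN0.le]
    exact Real.rpow_le_rpow (by linarith) (by linarith) (by linarith)
  have hNt : N ^ t = N * N ^ (-(1 - t)) := by
    rw [← Real.rpow_one_add' hN0.le (by linarith)]; congr 1; ring
  rw [div_le_iff₀ hM] at hsep
  have : N ≤ N * (2 * (2 * M * r) ^ t * M * N ^ (-(1 - t))) := by
    calc N ≤ _ := hsep
      _ ≤ 2 * ((2 * M * r) ^ t * N ^ t) * M := by gcongr; linarith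
      _ = _ := by rw [hNt]; ring
  nlinarith

end CrystalSST

namespace CrystalSST

/-! ### Differentiation of the transform in the position parameter -/

/-- Since f is only continuous and bounded, the derivative falls on the kernel. Moving b within a
unit ball costs the factor 8 in the dominating function. -/
theorem hasFDerivAt_integral_translate {K : Plane → ℂ} {K' : Plane → Plane →L[ℝ] ℂ} {f : Plane → ℂ}
    {B C : ℝ} (hK : ∀ u, HasFDerivAt K (K' u) u) (hK'c : Continuous K')
    (hKC : ∀ u, ‖K u‖ ≤ C * (1 + ‖u‖) ^ (-3 : ℝ)) (hK'C : ∀ u, ‖K' u‖ ≤ C * (1 + ‖u‖) ^ (-3 : ℝ))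
    (hC : 0 ≤ C) (hf : Continuous f) (hB : ∀ x, ‖f x‖ ≤ B) (b : Plane) :
    Integrable (fun x => K (x - b) * f x) ∧ Integrable (fun x => -(f x • K' (x - b))) ∧
      HasFDerivAt (fun b' => ∫ x, K (x - b') * f x) (∫ x, -(f x • K' (x - b))) b := by
  have hB0 : 0 ≤ B := (norm_nonneg _).trans (hB 0)
  have hKc : Continuous K := continuous_iff_continuousAt.2 fun u => (hK u).continuousAt
  have hdec : Integrable fun x : Plane => B * (C * (1 + ‖x - b‖) ^ (-3 : ℝ)) :=
    ((integrable_decay C).comp_sub_right b).const_mul B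
  have hdec8 : Integrable fun x : Plane => B * (C * (8 * (1 + ‖x - b‖) ^ (-3 : ℝ))) := by
    refine (hdec.const_mul 8).congr (ae_of_all _ fun x => ?_)
    simp only; ring
  have hi1 : Integrable (fun x => K (x - b) * f x) := by
    refine hdec.mono' (by fun_prop) (ae_of_all _ fun x => ?_)
    rw [norm_mul, mul_comm]
    exact mul_le_mul (hB x) (hKC _) (norm_nonneg _) hB0
  have hc2 : ∀ b', Continuous (fun x => -(f x • K' (x - b'))) := fun b' => by fun_prop
  have hi2 : Integrable (fun x => -(f x • K' (x - b))) := by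
    refine hdec.mono' (hc2 b).aestronglyMeasurable (ae_of_all _ fun x => ?_)
    rw [norm_neg, norm_smul]
    exact mul_le_mul (hB x) (hK'C _) (norm_nonneg _) hB0
  refine ⟨hi1, hi2, ?_⟩
  refine hasFDerivAt_integral_of_dominated_of_fderiv_le (s := Metric.ball b 1)
    (F := fun b' x => K (x - b') * f x) (F' := fun b' x => -(f x • K' (x - b')))
    (bound := fun x => B * (C * (8 * (1 + ‖x - b‖) ^ (-3 : ℝ))))
    (Metric.ball_mem_nhds b one_pos) (Eventually.of_forall fun b' => by fun_prop) hi1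
    (hc2 b).aestronglyMeasurable (ae_of_all _ fun x b' hb' => ?_) hdec8
    (ae_of_all _ fun x b' _ => ?_)
  · rw [norm_neg, norm_smul]
    refine mul_le_mul (hB x) ((hK'C _).trans (mul_le_mul_of_nonneg_left ?_ hC)) (norm_nonneg _) hB0
    have hz : ‖b - b'‖ ≤ 1 := by
      rw [Metric.mem_ball, dist_comm, dist_eq_norm] at hb'
      exact hb'.le
    have := one_add_norm_rpow_le (y := x - b) hz
    rwa [sub_add_sub_cancel] at this
  · have h1 : HasFDerivAt (fun b' : Plane => x - b') (-ContinuousLinearMap.id ℝ Plane) b' :=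
      (hasFDerivAt_id b').const_sub x
    have h2 := ((hK (x - b')).comp b' h1).mul_const (f x)
    refine h2.congr_fderiv ?_
    ext v
    simp

/-- The derivative of the transform is `2πi a e_θ W_f` up to a term of size `a^t a^{-(s+t)/2}`. -/
theorem exists_hasFDerivAt_transform {s t : ℝ} (hs : 0 ≤ s) (hst : s ≤ t) (w : 𝓢(Plane, ℂ))
    {f : Plane → ℂ} {B : ℝ} (hf : Continuous f) (hB : ∀ x, ‖f x‖ ≤ B) {a : ℝ} (ha : 1 ≤ a)
    (θ : ℝ) (b : Plane) :
    ∃ D : Plane →L[ℝ] ℂ, HasFDerivAt (fun b' => transform s t w f a θ b') D b ∧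
      ∀ v, ‖D v - 2 * Real.pi * Complex.I * (inner ℝ (a • unitVec θ) v : ℝ) *
        transform s t w f a θ b‖ ≤
        a ^ (-((s + t) / 2)) * (a ^ t * (B * ∫ y, ‖fderiv ℝ w y‖)) * ‖v‖ := by
  have ha0 : 0 < a := by linarith
  have hB0 : 0 ≤ B := (norm_nonneg _).trans (hB 0)
  obtain ⟨C, hC0, hwC, hwC'⟩ := exists_schwartz_bound w
  set A : ℝ := a ^ ((t + s) / 2) with hA
  have hA0 : 0 < A := by positivity
  set P := spaceCLM s t a θ with hP
  set l : Plane →L[ℝ] ℂ :=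
    (-(2 * Real.pi * Complex.I)) • (Complex.ofRealCLM ∘L innerSL ℝ (a • unitVec θ)) with hl
  have hlv : ∀ v, l v = -(2 * Real.pi * Complex.I * (inner ℝ (a • unitVec θ) v : ℝ)) := fun v => by
    simp [hl, real_inner_smul_left]
  set e : Plane → ℂ := fun u => (Real.fourierChar (-inner ℝ (a • unitVec θ) u) : ℂ) with he
  have hec : Continuous e := continuous_fourierChar_comp (by fun_prop)
  have hen : ∀ u, ‖e u‖ = 1 := fun u => Circle.norm_coe _
  have hed : ∀ u, HasFDerivAt e (e u • l) u := fun u => by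
    have h1 : e = fun u => Complex.exp (l u) := by
      ext u
      rw [hlv]
      refine (Real.fourierChar_apply _).trans ?_
      congr 1
      push_cast
      ring
    have h2 : HasFDerivAt (fun u => Complex.exp (l u)) (Complex.exp (l u) • l) u :=
      l.hasFDerivAt.cexp
    rw [h1]
    exact h2
  set q : Plane → Plane →L[ℝ] ℂ := fun u =>
    Complex.conjCLE.toContinuousLinearMap ∘L (fderiv ℝ w (P u) ∘L P) with hq
  have hwd : ∀ u, HasFDerivAt (fun u => conj (w (P u))) (q u) u := fun u =>
    Complex.conjCLE.toContinuousLinearMap.hasFDerivAt.comp u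
      ((w.differentiableAt (x := P u)).hasFDerivAt.comp u P.hasFDerivAt)
  have hfdc : Continuous (fderiv ℝ w) := (w.smooth 1).continuous_fderiv one_ne_zero
  have hqc : Continuous q := by fun_prop
  have hqn : ∀ u, ‖q u‖ ≤ ‖fderiv ℝ w (P u)‖ * ‖P‖ := fun u => by
    refine ContinuousLinearMap.opNorm_le_bound _ (by positivity) fun v => ?_
    simp only [hq, ContinuousLinearMap.comp_apply, ContinuousLinearEquiv.coe_coe,
      Complex.conjCLE_apply, RCLike.norm_conj]
    exact (((fderiv ℝ w (P u)).comp P).le_opNorm v).trans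
      (mul_le_mul_of_nonneg_right (ContinuousLinearMap.opNorm_comp_le _ _) (norm_nonneg _))
  set K : Plane → ℂ := fun u => (A : ℂ) * (e u * conj (w (P u))) with hKdef
  set K' : Plane → Plane →L[ℝ] ℂ := fun u =>
    (A : ℂ) • (e u • q u + conj (w (P u)) • (e u • l)) with hK'def
  have hK : ∀ u, HasFDerivAt K (K' u) u := fun u => ((hed u).mul (hwd u)).const_mul (A : ℂ)
  have hwc : Continuous w := w.continuous
  have hK'c : Continuous K' := by fun_prop
  have hdecay : ∀ u : Plane, (1 + ‖P u‖) ^ (-3 : ℝ) ≤ (1 + ‖u‖) ^ (-3 : ℝ) := fun u =>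
    Real.rpow_le_rpow_of_nonpos (by positivity)
      (by have : ‖u‖ ≤ ‖P u‖ := norm_le_norm_spaceMap hs (hs.trans hst) ha θ u
          linarith) (by norm_num)
  -- A crude constant depending on a; it serves domination only and is absent from the final bound.
  set C' := A * (C * ‖P‖ + C * ‖l‖ + C) with hC'
  have hC'0 : 0 ≤ C' := by positivity
  have hwu : ∀ u, ‖w (P u)‖ ≤ C * (1 + ‖u‖) ^ (-3 : ℝ) := fun u =>
    (hwC _).trans (mul_le_mul_of_nonneg_left (hdecay u) hC0.le)
  have hwu' : ∀ u, ‖fderiv ℝ w (P u)‖ ≤ C * (1 + ‖u‖) ^ (-3 : ℝ) := fun u =>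
    (hwC' _).trans (mul_le_mul_of_nonneg_left (hdecay u) hC0.le)
  have hAn : ‖(A : ℂ)‖ = A := by rw [Complex.norm_real, Real.norm_eq_abs, abs_of_pos hA0]
  have hKC : ∀ u, ‖K u‖ ≤ C' * (1 + ‖u‖) ^ (-3 : ℝ) := fun u => by
    rw [hKdef, norm_mul, norm_mul, hen, one_mul, RCLike.norm_conj, hAn, hC', mul_assoc]
    refine mul_le_mul_of_nonneg_left ((hwu u).trans ?_) hA0.le
    refine mul_le_mul_of_nonneg_right ?_ (by positivity)
    linarith [mul_nonneg hC0.le (norm_nonneg P), mul_nonneg hC0.le (norm_nonneg l)]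
  have hK'C : ∀ u, ‖K' u‖ ≤ C' * (1 + ‖u‖) ^ (-3 : ℝ) := fun u => by
    rw [hK'def, norm_smul, hAn, hC', mul_assoc]
    refine mul_le_mul_of_nonneg_left ?_ hA0.le
    calc _ ≤ ‖fderiv ℝ w (P u)‖ * ‖P‖ + ‖w (P u)‖ * ‖l‖ := by
          refine (norm_add_le _ _).trans (add_le_add ?_ ?_)
          · rw [norm_smul, hen, one_mul]; exact hqn u
          · rw [norm_smul, norm_smul, hen, one_mul, RCLike.norm_conj]
      _ ≤ C * (1 + ‖u‖) ^ (-3 : ℝ) * ‖P‖ + C * (1 + ‖u‖) ^ (-3 : ℝ) * ‖l‖ := by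
          gcongr
          · exact hwu' u
          · exact hwu u
      _ ≤ (C * ‖P‖ + C * ‖l‖ + C) * (1 + ‖u‖) ^ (-3 : ℝ) := by
          have : 0 ≤ C * (1 + ‖u‖) ^ (-3 : ℝ) := by positivity
          linarith
  obtain ⟨hi1, hi2, hD⟩ := hasFDerivAt_integral_translate hK hK'c hKC hK'C hC'0 hf hB b
  have htr : ∀ b', transform s t w f a θ b' = ∫ x, K (x - b') * f x := fun b' => by
    rw [transform]
    refine integral_congr_ae (ae_of_all _ fun x => ?_)
    simp only [conj_wavePacket]
    rfl
  refine ⟨∫ x, -(f x • K' (x - b)), by simpa only [htr] using hD, fun v => ?_⟩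
  -- By the product rule, differentiating the exponential reproduces 2πi a e_θ times the integrand
  -- exactly; only the derivative of w survives.
  have hpt : ∀ x, (-(f x • K' (x - b))) v -
      2 * Real.pi * Complex.I * (inner ℝ (a • unitVec θ) v : ℝ) * (K (x - b) * f x) =
      -(f x * ((A : ℂ) * (e (x - b) * q (x - b) v))) := fun x => by
    simp only [hK'def, hKdef, neg_apply, smul_apply,
      add_apply, smul_eq_mul, hlv]
    ring
  rw [ContinuousLinearMap.integral_apply hi2, htr, ← integral_const_mul,
    ← integral_sub (hi2.apply_continuousLinearMap v) (hi1.const_mul _)]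
  simp_rw [hpt]
  have hPt : ‖P‖ ≤ a ^ t := norm_spaceCLM_le hst ha θ
  have hcv : ∫ x, ‖fderiv ℝ w (P (x - b))‖ = a ^ (-(t + s)) * ∫ y, ‖fderiv ℝ w y‖ := by
    rw [integral_comp_spaceInv s t ha0 θ b, smul_eq_mul]
    congr 1
    refine integral_congr_ae (ae_of_all _ fun y => ?_)
    simp only [add_sub_cancel_left, hP, spaceCLM_apply, spaceMap_spaceInv s t ha0]
  have hfi : Integrable fun x => ‖fderiv ℝ w (P (x - b))‖ := by
    have h1 : Integrable fun x : Plane => C * (1 + ‖x - b‖) ^ (-3 : ℝ) :=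
      (integrable_decay C).comp_sub_right b
    refine h1.mono' (by fun_prop) (ae_of_all _ fun x => ?_)
    rw [norm_norm]
    exact hwu' _
  have hbound := norm_integral_le_of_norm_le (hfi.const_mul (B * (A * (a ^ t * ‖v‖))))
    (f := fun x => -(f x * ((A : ℂ) * (e (x - b) * q (x - b) v)))) (ae_of_all _ fun x => by
      rw [norm_neg, norm_mul, norm_mul, norm_mul, hen, one_mul, hAn, mul_assoc, mul_assoc]
      refine mul_le_mul (hB x) (mul_le_mul_of_nonneg_left ?_ hA0.le) (by positivity) hB0
      calc _ ≤ ‖q (x - b)‖ * ‖v‖ := ContinuousLinearMap.le_opNorm _ _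
        _ ≤ ‖fderiv ℝ w (P (x - b))‖ * a ^ t * ‖v‖ := by
            gcongr
            exact (hqn _).trans (mul_le_mul_of_nonneg_left hPt (norm_nonneg _))
        _ = _ := by ring)
  refine hbound.trans (le_of_eq ?_)
  have e1 : a ^ (-((s + t) / 2)) = a ^ (-(t + s)) * A := by
    rw [hA, ← Real.rpow_add ha0]; congr 1; ring
  rw [integral_const_mul, hcv, e1]
  ring

theorem norm_toComplex (v : Plane) : ‖toComplex v‖ = ‖v‖ := by
  rw [← sq_eq_sq₀ (norm_nonneg _) (norm_nonneg _), EuclideanSpace.norm_sq_eq,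
    EuclideanSpace.norm_sq_eq]
  simp [toComplex]

theorem norm_le_sum_coord (v : EuclideanSpace ℂ (Fin 2)) : ‖v‖ ≤ ‖v 0‖ + ‖v 1‖ := by
  refine le_of_sq_le_sq ?_ (by positivity)
  rw [EuclideanSpace.norm_sq_eq, Fin.sum_univ_two]
  nlinarith [norm_nonneg (v 0), norm_nonneg (v 1)]

/-- Each coordinate of the error is the derivative error divided by 2πi W, with |2π| ≥ 1 discarded;
the 2 counts coordinates. -/
theorem norm_waveVectorEstimate_sub_le {s t : ℝ} {w : 𝓢(Plane, ℂ)} {f : Plane → ℂ}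
    {a θ Q η : ℝ} {b : Plane} {D : Plane →L[ℝ] ℂ}
    (hD : HasFDerivAt (fun b' => transform s t w f a θ b') D b) {κ : Plane}
    (hDκ : ∀ v, ‖D v - 2 * Real.pi * Complex.I * (inner ℝ κ v : ℝ) *
      transform s t w f a θ b‖ ≤ Q * ‖v‖)
    (hη : 0 < η) (hW : η ≤ ‖transform s t w f a θ b‖) :
    ‖waveVectorEstimate s t w f a θ b - toComplex κ‖ ≤ 2 * (Q / η) := by
  set W := transform s t w f a θ b with hWdef
  have hW0 : W ≠ 0 := norm_pos_iff.1 (hη.trans_le hW)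
  have hc0 : 2 * (Real.pi : ℂ) * Complex.I ≠ 0 := Complex.two_pi_I_ne_zero
  have hcoord : ∀ i, ‖(waveVectorEstimate s t w f a θ b - toComplex κ) i‖ ≤ Q / η := fun i => by
    have e1 : (waveVectorEstimate s t w f a θ b - toComplex κ) i =
        (D (EuclideanSpace.single i 1) - 2 * Real.pi * Complex.I *
          (inner ℝ κ (EuclideanSpace.single i (1 : ℝ)) : ℝ) * W) /
          (2 * Real.pi * Complex.I * W) := by
      rw [EuclideanSpace.inner_single_right, sub_div, PiLp.sub_apply, waveVectorEstimate,
        toComplex, hD.fderiv, ← hWdef]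
      simp only [one_mul, conj_trivial]
      congr 1
      rw [mul_right_comm, mul_div_cancel_left₀ _ (mul_ne_zero hc0 hW0)]
    have h1 := hDκ (EuclideanSpace.single i 1)
    rw [PiLp.norm_single, norm_one, mul_one] at h1
    have h2 : η ≤ ‖2 * (Real.pi : ℂ) * Complex.I * W‖ := by
      rw [norm_mul, norm_mul, norm_mul, Complex.norm_I, mul_one, Complex.norm_real,
        Complex.norm_ofNat, Real.norm_eq_abs, abs_of_pos Real.pi_pos]
      refine hW.trans (le_mul_of_one_le_left (norm_nonneg _) ?_)
      linarith [Real.pi_gt_three]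
    rw [e1, norm_div]
    exact div_le_div₀ ((norm_nonneg _).trans h1) h1 hη h2
  refine (norm_le_sum_coord _).trans ?_
  linarith [hcoord 0, hcoord 1]

/-- On `R_ε ∩ Z_n` the estimate `v_f` is close to the local wave vector when `N` is large. -/
theorem exists_estimate {s t d M : ℝ} (hs : 1 / 2 < s) (hst : s ≤ t) (ht : t < 1)
    (hd1 : d ≤ 1) (hM : 0 < M) (w : 𝓢(Plane, ℂ)) (r : ℝ) {ε : ℝ} (hε : 0 < ε) :
    ∃ N₀ : ℝ, ∀ N, N₀ ≤ N → 0 ≤ N → ∀ F : Matrix (Fin 2) (Fin 2) ℝ,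
      (∀ n : Fin 2 → ℤ, n ≠ 0 → 1 ≤ ‖rowVec F n‖) → ∀ α S φ f, IsGIMT M N F α S φ f →
        ∀ n ∈ spectrum2 S, ∀ (a θ : ℝ) (b : Plane),
          (a, θ, b) ∈ setR s t w M N r ε f ∩ setZ s t d M N r F φ n →
          DifferentiableAt ℝ (fun b' => transform s t w f a θ b') b ∧
          ‖waveVectorEstimate s t w f a θ b - toComplex (localWaveVector N F φ n b)‖ /
            ‖localWaveVector N F φ n b‖ ≤ √ε := by
  have hsq : 0 < √ε := Real.sqrt_pos.2 hε
  set J := M * M * ∫ y, ‖fderiv ℝ w y‖ with hJ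
  have hJ0 : 0 ≤ J := mul_nonneg (by positivity) (integral_nonneg fun y => norm_nonneg _)
  -- The total error is Q a^t: the 1 from the width of Z_n, the rest from the derivative term.
  set Q := 1 + 2 * (J / √ε) with hQ
  have hQ0 : 0 ≤ Q := by positivity
  have hlim : Tendsto (fun a : ℝ => a ^ (-(1 - t))) atTop (nhds 0) :=
    tendsto_rpow_neg_atTop (by linarith)
  have hlim2 : Tendsto (fun a : ℝ => 2 * Q * a ^ (-(1 - t))) atTop (nhds 0) := by
    simpa using hlim.const_mul (2 * Q)
  obtain ⟨a₀, ha₀⟩ := eventually_atTop.1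
    ((hlim.eventually_le_const (by norm_num : (0 : ℝ) < 1 / 2)).and (hlim2.eventually_le_const hsq))
  -- On Z_n the local wave vector has norm at least N/M and at most 2a, so this bound on N forces a
  -- ≥ a₀.
  refine ⟨2 * M * a₀, fun N hN hN0 F hF α S φ f h n hn a θ b ⟨hR, hZ⟩ => ?_⟩
  have ha : 1 ≤ a := hR.1.1
  have ha0 : 0 < a := by linarith
  have hFn := hF n (h.shape.ne_zero_of_mem hn)
  have hpos : 0 < a ^ (-((s + t) / 2)) := by positivity
  obtain ⟨D, hD, hDv⟩ := exists_hasFDerivAt_transform (by linarith) hst w h.continuous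
    (h.norm_le hM) ha θ b
  refine ⟨hD.differentiableAt, ?_⟩
  set κ := localWaveVector N F φ n b with hκ
  have h1 := norm_waveVectorEstimate_sub_le hD hDv (mul_pos hpos hsq) hR.2
  rw [mul_div_mul_left _ _ hpos.ne', ← hJ, mul_div_assoc] at h1
  have h2 : ‖a • unitVec θ - κ‖ ≤ a ^ t :=
    (norm_le_of_norm_freqMap_le hst ha θ hZ.2).trans (mul_le_of_le_one_right (by positivity) hd1)
  have hae : ‖a • unitVec θ‖ = a := by
    rw [norm_smul, norm_unitVec, Real.norm_eq_abs, abs_of_pos ha0, mul_one]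
  have hta : a ^ t = a * a ^ (-(1 - t)) := by
    rw [← Real.rpow_one_add' ha0.le (by linarith)]; congr 1; ring
  have hta1 : a ^ t ≤ a := by
    simpa using Real.rpow_le_rpow_of_exponent_le ha ht.le
  have hκle : ‖κ‖ ≤ 2 * a := by
    have := norm_sub_norm_le κ (a • unitVec θ)
    rw [norm_sub_rev, hae] at this
    linarith
  have haN : a₀ ≤ a := by
    have hlow := (h.isWave hM hN0 hn hFn).grad_lower b
    have : N / M ≤ 2 * a := by
      refine le_trans ?_ (hlow.trans hκle)
      gcongr
      exact le_mul_of_one_le_right hN0 hFn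
    rw [div_le_iff₀ hM] at this
    nlinarith
  obtain ⟨hhalf, hfin⟩ := ha₀ a haN
  have hκge : a / 2 ≤ ‖κ‖ := by
    have := norm_sub_norm_le (a • unitVec θ) κ
    rw [hae] at this
    nlinarith
  rw [div_le_iff₀ (by linarith)]
  have htri : waveVectorEstimate s t w f a θ b - toComplex κ =
      (waveVectorEstimate s t w f a θ b - toComplex (a • unitVec θ)) +
        toComplex (a • unitVec θ - κ) := by
    ext i
    simp [toComplex]
  calc _ ≤ 2 * (a ^ t * (J / √ε)) + a ^ t := by
        rw [htri]
        refine (norm_add_le _ _).trans (add_le_add h1 ?_)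
        rw [norm_toComplex]
        exact h2
    _ = (2 * Q * a ^ (-(1 - t))) * (a / 2) := by rw [hta, hQ]; ring
    _ ≤ √ε * ‖κ‖ := mul_le_mul hfin hκge (by positivity) hsq.le

end CrystalSST

end

/-! ### Assembly of the three thresholds -/

theorem mainTheorem1 (s t d M : ℝ) (hs : 1 / 2 < s) (hst : s ≤ t) (ht : t < 1)
    (hd : 0 < d) (hd1 : d ≤ 1) (hM : 0 < M)
    (w : SchwartzMap CrystalSST.Plane ℂ) (hw : CrystalSST.IsMotherWavePacket s t d w) :
    ∃ C : ℝ, 0 < C ∧ ∀ r : ℝ, 1 < r → ∀ ε : ℝ, 0 < ε → ∃ N₀ : ℝ, 0 < N₀ ∧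
      ∀ N : ℝ, N₀ < N → ∀ F : Matrix (Fin 2) (Fin 2) ℝ,
        (∀ n : Fin 2 → ℤ, n ≠ 0 → 1 ≤ ‖CrystalSST.rowVec F n‖) →
        ∀ (α : CrystalSST.Plane → ℝ) (S : CrystalSST.Plane → ℂ)
          (φ : CrystalSST.Plane → CrystalSST.Plane) (f : CrystalSST.Plane → ℂ),
          CrystalSST.IsGIMT M N F α S φ f →
          ((CrystalSST.spectrum2 S).PairwiseDisjoint (CrystalSST.setZ s t d M N r F φ) ∧
            CrystalSST.setR s t w M N r ε f ⊆
              ⋃ n ∈ CrystalSST.spectrum2 S, CrystalSST.setZ s t d M N r F φ n) ∧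
          ∀ n ∈ CrystalSST.spectrum2 S, ∀ (a θ : ℝ) (b : CrystalSST.Plane),
            (a, θ, b) ∈ CrystalSST.setR s t w M N r ε f ∩ CrystalSST.setZ s t d M N r F φ n →
            DifferentiableAt ℝ (fun b' => CrystalSST.transform s t w f a θ b') b ∧
            ‖CrystalSST.waveVectorEstimate s t w f a θ b -
                CrystalSST.toComplex (CrystalSST.localWaveVector N F φ n b)‖ /
              ‖CrystalSST.localWaveVector N F φ n b‖ ≤ C * √ε := by
  -- C = 1 suffices, since for fixed ε the relative error tends to zero as N grows.
  refine ⟨1, one_pos, fun r hr ε hε => ?_⟩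
  obtain ⟨N₁, h₁⟩ := CrystalSST.exists_setR_subset hs hst ht hM hw r hε
  obtain ⟨N₂, h₂⟩ := CrystalSST.exists_setZ_disjoint hs hst ht hd1 hM (one_pos.trans hr)
  obtain ⟨N₃, h₃⟩ := CrystalSST.exists_estimate hs hst ht hd1 hM w r hε
  refine ⟨max 1 (max N₁ (max N₂ N₃)), lt_max_of_lt_left one_pos,
    fun N hN F hF α S φ f h => ?_⟩
  obtain ⟨hN0, hN1, hN2, hN3⟩ : 1 < N ∧ N₁ < N ∧ N₂ < N ∧ N₃ < N := by
    simpa only [max_lt_iff] using hN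
  have hN' : 0 ≤ N := by linarith
  refine ⟨⟨h₂ N hN2.le hN' F hF α S φ f h, h₁ N hN1.le hN' F hF α S φ f h⟩,
    fun n hn a θ b hp => ?_⟩
  rw [one_mul]
  exact h₃ N hN3.le hN' F hF α S φ f h n hn a θ b hp
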